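/- All modules are left modules, and endomorphisms of a left module act on the right (so that the product $fg$ in an endomorphism ring is first $f$, then $g$). Definitions. (a) Let $R$ be a commutative local artinian ring. An artin $R$-algebra is an $R$-algebra that is finitely generated as an $R$-module. A two-sided ideal $I$ of an artin algebra $\Gamma$ with Jacobson radical $J_\Gamma$ is called heredity if $I^2=I$, $IJ_\Gamma I=0$ and $I$ is a finitely generated projective left $\Gamma$-module. An artin algebra $\Gamma$ is quasi-hereditary if there is a chain $0=I_m\subseteq I_{m-1}\subseteq\cdots\subseteq I_0=\Gamma$ of two-sided ideals such that $I_{n-1}/I_n$ is a heredity ideal of $\Gamma/I_n$ for all $0<n\le m$. (b) Let $R$ be a complete discrete valuation ring with quotient field $K$. An $R$-order is an $R$-algebra $\Lambda$ that is finitely generated and projective as an $R$-module; it is an order in a semisimple algebra if $\Lambda\otimes_RK$ is semisimple. A $\Lambda$-lattice is a $\Lambda$-module that is finitely generated and projective as an $R$-module. An $R$-order $\Lambda$ is maximal if every injective morphism of $R$-algebras from $\Lambda$ to an $R$-order whose cokernel is $R$-torsion is bijective. An $R$-order $\Gamma$ is quasi-hereditary if there is an idempotent $e\in\Gamma$ such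 that $e\Gamma e$ is a maximal order and $\Gamma/\Gamma e\Gamma$ is a quasi-hereditary artin algebra (over $R/\mathfrak m^n$ for some $n\ge1$, where $\mathfrak m$ is the maximal ideal of $R$). Theorem. (1) Let $\Lambda$ be an artin algebra over a commutative local artinian ring $R$. For every finitely generated $\Lambda$-module $M$ there is a finitely generated $\Lambda$-module $N$ such that $\operatorname{End}_\Lambda(M\oplus N)$ is a quasi-hereditary artin $R$-algebra. (2) Let $R$ be a complete discrete valuation ring and $\Lambda$ an $R$-order in a semisimple algebra. For every $\Lambda$-lattice $M$ there is a $\Lambda$-lattice $N$ such that $\operatorname{End}_\Lambda(M\oplus N)$ is a quasi-hereditary $R$-order. -/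

import Mathlib

open scoped TensorProduct MulOpposite

universe u v w

/-- The corner ring `eAe` of an `R`-algebra `A` is an `R`-algebra. -/
instance cornerAlgebra {R A : Type*} [CommRing R] [Ring A] [Algebra R A] {e : A}
    (he : IsIdempotentElem e) : Algebra R he.Corner where
  smul r x := ⟨r • x.1, by
    obtain ⟨a, ha⟩ := x.2
    exact ⟨r • a, by simp only [← ha, mul_smul_comm, smul_mul_assoc]⟩⟩
  algebraMap :=
    { toFun := fun r => ⟨r • e, r • e, by
        simp only [mul_smul_comm, smul_mul_assoc, he.eq]⟩
      map_one' := Subtype.ext (one_smul R e)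
      map_mul' := fun r s => Subtype.ext <| by
        change (r * s) • e = (r • e) * (s • e)
        simp only [mul_smul_comm, smul_mul_assoc, he.eq, smul_smul, mul_comm]
      map_zero' := Subtype.ext (zero_smul R e)
      map_add' := fun r s => Subtype.ext (add_smul r s e) }
  commutes' r x := Subtype.ext <| by
    change (r • e) * x.1 = x.1 * (r • e)
    rw [smul_mul_assoc, mul_smul_comm, ((Subsemigroup.mem_corner_iff he).mp x.2).1,
      ((Subsemigroup.mem_corner_iff he).mp x.2).2]
  smul_def' r x := Subtype.ext <| by
    change r • x.1 = (r • e) * x.1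
    rw [smul_mul_assoc, ((Subsemigroup.mem_corner_iff he).mp x.2).1]

/-- `A` is an artin `R`-algebra: `R` is a commutative local artinian ring and the `R`-algebra `A`
is a finitely generated `R`-module. -/
structure IsArtinAlgebra (R A : Type*) [CommRing R] [Ring A] [Algebra R A] : Prop where
  isLocalRing : IsLocalRing R
  isArtinianRing : IsArtinianRing R
  finite : Module.Finite R A

/-- `X` is a finitely generated projective `R`-module. For an order `A` over the complete discrete
valuation ring `R`, the `A`-modules with this property are the `A`-lattices. -/
structure IsLattice (R X : Type*) [CommRing R] [AddCommGroup X] [Module R X] : Prop where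
  finite : Module.Finite R X
  projective : Module.Projective R X

/-- The `R`-algebra `A` is an `R`-order (used for a complete discrete valuation ring `R`). -/
def IsOrder (R A : Type*) [CommRing R] [Ring A] [Algebra R A] : Prop :=
  IsLattice R A

/-- The `R`-order `A` is an order in a semisimple algebra: `K ⊗ A` is semisimple, where `K` is the
quotient field of `R`. -/
structure IsOrderInSemisimple (R A : Type*) [CommRing R] [Ring A] [Algebra R A] : Prop where
  isOrder : IsOrder R A
  semisimple : IsSemisimpleRing (FractionRing R ⊗[R] A)

/-- The `R`-order `A` is maximal: it has no proper overorder, that is, every injective morphism of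
`R`-algebras `φ : A → B` to an `R`-order `B` whose cokernel is an `R`-torsion module is bijective.
An overorder `B` satisfies `r B ⊆ φ(A)` for some nonzero `r` in `R`, so, up to isomorphism, all
overorders lie in the universe of `A`. -/
structure IsMaximalOrder (R : Type u) (A : Type v) [CommRing R] [Ring A] [Algebra R A] : Prop where
  isOrder : IsOrder R A
  surjective : ∀ (B : Type v) [Ring B] [Algebra R B], IsOrder R B → ∀ φ : A →ₐ[R] B,
    Function.Injective φ → Module.IsTorsion R (B ⧸ LinearMap.range φ.toLinearMap) →
      Function.Surjective φ

/-- The two-sided ideal `I` of `A` is a heredity ideal: `I² = I`, `I J I = 0` for the Jacobson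
radical `J` of `A`, and `I` is a finitely generated projective left `A`-module. -/
structure IsHeredityIdeal {A : Type*} [Ring A] (I : Ideal A) : Prop where
  isTwoSided : I.IsTwoSided
  mul_self : I * I = I
  mul_jacobson_mul : I * Ring.jacobson A * I = ⊥
  finite : Module.Finite A I
  projective : Module.Projective A I

/-- `A` has a heredity chain: a chain `0 = I m ⊆ ⋯ ⊆ I 1 ⊆ I 0 = A` of two-sided ideals such that
`I n / I (n + 1)` is a heredity ideal of the ring `A / I (n + 1)` for all `n < m`. -/
def HasHeredityChain (A : Type*) [Ring A] : Prop :=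
  ∃ (m : ℕ) (I : ℕ → Ideal A) (_ : ∀ n, (I n).IsTwoSided), I 0 = ⊤ ∧ I m = ⊥ ∧
    ∀ n < m, I (n + 1) ≤ I n ∧
      IsHeredityIdeal ((I n).map (Ideal.Quotient.mk (I (n + 1))))

/-- The `R`-algebra `A` is a quasi-hereditary artin algebra. This is used for a local ring `R`
which is artinian or a discrete valuation ring. Then `A` has finite length as an `R`-module if and
only if `A` is an artin algebra over `R / 𝔪 ^ n` for some `n ≥ 1`, where `𝔪` is the maximal
ideal of `R`. -/
structure IsQuasiHereditaryAlgebra (R A : Type*) [CommRing R] [Ring A] [Algebra R A] :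
    Prop where
  isFiniteLength : IsFiniteLength R A
  hasHeredityChain : HasHeredityChain A

/-- The `R`-algebra `A` is a quasi-hereditary order: it is an order with an idempotent `e` such that
the order `eAe` is maximal and `A / AeA` is a quasi-hereditary artin algebra. The two-sided ideal
`AeA` is the product of the left ideals `Ae` and `A`. -/
structure IsQuasiHereditaryOrder (R A : Type*) [CommRing R] [Ring A] [Algebra R A] : Prop where
  isOrder : IsOrder R A
  exists_idempotent : ∃ (e : A) (he : IsIdempotentElem e),
    IsMaximalOrder R he.Corner ∧
      IsQuasiHereditaryAlgebra R (A ⧸ (Ideal.span {e} * (⊤ : Ideal A)))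

/-- The endomorphism ring of a left `A`-module, where endomorphisms act on the right: the product
`f g` is first `f`, then `g`. -/
abbrev RightEnd (A X : Type*) [Ring A] [AddCommGroup X] [Module A X] : Type _ :=
  (Module.End A X)ᵐᵒᵖ

/-! Starting with L = M, one repeatedly replaces L by a submodule L' = L·I (`idealRange I`), where I
is a two-sided ideal of End(L) containing the Jacobson radical J. N is the sum of the modules
obtained after M. Endomorphisms act on the right.

Let C be the sum of L' and all later terms. Since L·J ⊆ L', radical endomorphisms of L factor
through C, so End(L) modulo the maps through C is semisimple. This makes each step heredity. Let X
be a module having L × C as a summand, with the trace of L × C in X in add(L × C). The ideal of maps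
X → X through L × C is then Hom(X, trace), hence projective (`facIdeal_finite_projective`).
Composing two of its elements around a radical element gives a map through C
(`comp_mem_facMaps_prod`). The trace condition passes from L × C to C because L generates C and
End(L)/J is semisimple (`traceInAdd_of_jacobson_range_le`). `HasHeredityCompletion.step` assembles
this.

For artin algebras take I = J. Nilpotency of J makes L·J smaller than L until L = 0, and the maps
through 0 form the bottom of the heredity chain.

For orders the process goes on while, for some I ⊇ J, an endomorphism of L·I does not extend to L.
Passing to L·I then strictly enlarges the stabilizer of the lattice in the semisimple algebra End(K
⊗ M), and full orders there satisfy the ascending chain condition (`wellFoundedGT_full_orders`). At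
the last lattice B all these endomorphisms extend, which forces End(B) to be maximal
(`isMaximalOrder_rightEnd`). If e is the projection of M × N onto B and Γ = End(M × N), then ΓeΓ
consists of the maps through B. The chain above it makes Γ/ΓeΓ quasi-hereditary, and ϖL ⊆ L' at
every step gives it finite length. -/

/-! ### Maps factoring through a module, and traces -/

section FactoringMaps

variable (Λ : Type*) [Ring Λ]
variable (C : Type*) [AddCommGroup C] [Module Λ C]
variable (D : Type*) [AddCommGroup D] [Module Λ D]
variable (A : Type*) [AddCommGroup A] [Module Λ A]
variable (B : Type*) [AddCommGroup B] [Module Λ B]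

/-- The maps `A → B` that are finite sums of maps factoring through `C`; equivalently, the maps
that factor through a finite power of `C`. -/
def facMaps : AddSubgroup (A →ₗ[Λ] B) :=
  AddSubgroup.closure {h | ∃ (g : A →ₗ[Λ] C) (f : C →ₗ[Λ] B), f ∘ₗ g = h}

/-- `C` is a direct summand of `A`, up to isomorphism. -/
def IsSummand : Prop := ∃ (i : C →ₗ[Λ] A) (p : A →ₗ[Λ] C), p ∘ₗ i = LinearMap.id

/-- The trace of `C` in `A`: the sum of the images of all maps `C → A`. -/
def traceSubmodule : Submodule Λ A := ⨆ f : C →ₗ[Λ] A, LinearMap.range f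

/-- The trace of `C` in `A` is a direct summand of a finite power of `C`. -/
def TraceInAdd : Prop :=
  (LinearMap.id : traceSubmodule Λ C A →ₗ[Λ] traceSubmodule Λ C A) ∈
    facMaps Λ C (traceSubmodule Λ C A) (traceSubmodule Λ C A)

variable {Λ C D A B}

theorem comp_mem_facMaps (f : C →ₗ[Λ] B) (g : A →ₗ[Λ] C) : f ∘ₗ g ∈ facMaps Λ C A B :=
  AddSubgroup.subset_closure ⟨g, f, rfl⟩

theorem facMaps_comp_left {h : A →ₗ[Λ] B} (hh : h ∈ facMaps Λ C A B) (f : B →ₗ[Λ] D) :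
    f ∘ₗ h ∈ facMaps Λ C A D := by
  induction hh using AddSubgroup.closure_induction with
  | mem x hx =>
    obtain ⟨g, f', rfl⟩ := hx
    exact comp_mem_facMaps (f ∘ₗ f') g
  | zero => simp [zero_mem]
  | add x y _ _ hx hy => rw [LinearMap.comp_add]; exact add_mem hx hy
  | neg x _ hx => rw [LinearMap.comp_neg]; exact neg_mem hx

theorem facMaps_comp_right {h : A →ₗ[Λ] B} (hh : h ∈ facMaps Λ C A B) (f : D →ₗ[Λ] A) :
    h ∘ₗ f ∈ facMaps Λ C D B := by
  induction hh using AddSubgroup.closure_induction with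
  | mem x hx =>
    obtain ⟨g, f', rfl⟩ := hx
    exact comp_mem_facMaps f' (g ∘ₗ f)
  | zero => simp [zero_mem]
  | add x y _ _ hx hy => rw [LinearMap.add_comp]; exact add_mem hx hy
  | neg x _ hx => rw [LinearMap.neg_comp]; exact neg_mem hx

theorem facMaps_le_of_id_mem (h : LinearMap.id ∈ facMaps Λ D C C) :
    facMaps Λ C A B ≤ facMaps Λ D A B := by
  rw [facMaps, AddSubgroup.closure_le]
  rintro _ ⟨g, f, rfl⟩
  exact facMaps_comp_left (facMaps_comp_right h g) f

theorem IsSummand.id_mem (h : IsSummand Λ C D) : LinearMap.id ∈ facMaps Λ D C C := by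
  obtain ⟨i, p, hip⟩ := h
  rw [← hip]
  exact comp_mem_facMaps p i

theorem IsSummand.refl : IsSummand Λ C C := ⟨LinearMap.id, LinearMap.id, rfl⟩

theorem IsSummand.trans (h : IsSummand Λ C D) (h' : IsSummand Λ D A) : IsSummand Λ C A := by
  obtain ⟨i, p, hip⟩ := h
  obtain ⟨j, q, hjq⟩ := h'
  refine ⟨j ∘ₗ i, p ∘ₗ q, ?_⟩
  rw [LinearMap.comp_assoc, ← LinearMap.comp_assoc _ _ q, hjq, LinearMap.id_comp, hip]

theorem IsSummand.prod_left : IsSummand Λ C (C × D) :=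
  ⟨LinearMap.inl Λ C D, LinearMap.fst Λ C D, LinearMap.fst_comp_inl _ _ _⟩

theorem IsSummand.prod_right : IsSummand Λ D (C × D) :=
  ⟨LinearMap.inr Λ C D, LinearMap.snd Λ C D, LinearMap.snd_comp_inr _ _ _⟩

theorem range_le_traceSubmodule (f : C →ₗ[Λ] A) : LinearMap.range f ≤ traceSubmodule Λ C A :=
  le_iSup (fun f : C →ₗ[Λ] A => LinearMap.range f) f

theorem map_traceSubmodule_le (f : A →ₗ[Λ] B) :
    (traceSubmodule Λ C A).map f ≤ traceSubmodule Λ C B := by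
  rw [traceSubmodule, Submodule.map_iSup]
  refine iSup_le fun g => ?_
  rw [← LinearMap.range_comp]
  exact range_le_traceSubmodule _

theorem range_le_traceSubmodule_of_mem {h : A →ₗ[Λ] B} (hh : h ∈ facMaps Λ C A B) :
    LinearMap.range h ≤ traceSubmodule Λ C B := by
  rintro _ ⟨a, rfl⟩
  induction hh using AddSubgroup.closure_induction with
  | mem x hx =>
    obtain ⟨g, f', rfl⟩ := hx
    exact range_le_traceSubmodule f' ⟨g a, rfl⟩
  | zero => exact zero_mem _
  | add x y _ _ hx hy => exact add_mem hx hy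
  | neg x _ hx => exact neg_mem hx

theorem traceSubmodule_eq_top_of_id_mem (h : LinearMap.id ∈ facMaps Λ C A A) :
    traceSubmodule Λ C A = ⊤ := by
  rw [eq_top_iff]
  exact fun x _ => range_le_traceSubmodule_of_mem h ⟨x, rfl⟩

theorem traceSubmodule_eq_top_trans (h : traceSubmodule Λ C D = ⊤)
    (h' : traceSubmodule Λ D A = ⊤) : traceSubmodule Λ C A = ⊤ := by
  rw [eq_top_iff, ← h', traceSubmodule]
  refine iSup_le fun f => ?_
  rw [LinearMap.range_eq_map, ← h]
  exact map_traceSubmodule_le f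

theorem traceSubmodule_prod_eq_top (h : traceSubmodule Λ C A = ⊤)
    (h' : traceSubmodule Λ C B = ⊤) : traceSubmodule Λ C (A × B) = ⊤ := by
  rw [eq_top_iff]
  rintro ⟨a, b⟩ -
  have ha : (a, (0 : B)) ∈ traceSubmodule Λ C (A × B) :=
    map_traceSubmodule_le (LinearMap.inl Λ A B) ⟨a, by simp [h], rfl⟩
  have hb : ((0 : A), b) ∈ traceSubmodule Λ C (A × B) :=
    map_traceSubmodule_le (LinearMap.inr Λ A B) ⟨b, by simp [h'], rfl⟩
  simpa using add_mem ha hb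

/-- The map of traces induced by a linear map. -/
def traceMap (C : Type*) [AddCommGroup C] [Module Λ C] (f : A →ₗ[Λ] B) :
    traceSubmodule Λ C A →ₗ[Λ] traceSubmodule Λ C B :=
  f.restrict fun x hx => map_traceSubmodule_le f ⟨x, hx, rfl⟩

@[simp]
theorem coe_traceMap (f : A →ₗ[Λ] B) (x : traceSubmodule Λ C A) :
    (traceMap C f x : B) = f x := rfl

/-- Taking traces is functorial: a map through D induces one through the trace of C in D, whose
identity factors through powers of C. -/
theorem traceMap_mem_facMaps (hC : TraceInAdd Λ C D) {h : A →ₗ[Λ] B}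
    (hh : h ∈ facMaps Λ D A B) :
    traceMap C h ∈ facMaps Λ C (traceSubmodule Λ C A) (traceSubmodule Λ C B) := by
  induction hh using AddSubgroup.closure_induction with
  | mem x hx =>
    obtain ⟨g, f, rfl⟩ := hx
    exact facMaps_comp_left (facMaps_comp_right hC (traceMap C g)) (traceMap C f)
  | zero => exact zero_mem _
  | add x y _ _ hx hy => exact add_mem hx hy
  | neg x _ hx => exact neg_mem hx

theorem TraceInAdd.of_id_mem (hC : TraceInAdd Λ C D) (h : LinearMap.id ∈ facMaps Λ D A A) :
    TraceInAdd Λ C A :=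
  traceMap_mem_facMaps hC h

theorem TraceInAdd.self : TraceInAdd Λ C C := by
  have h : ∀ x : C, x ∈ traceSubmodule Λ C C := fun x =>
    range_le_traceSubmodule LinearMap.id ⟨x, rfl⟩
  exact comp_mem_facMaps (LinearMap.id.codRestrict _ h) (Submodule.subtype _)

/-- As C is in add D, maps C → A land in the trace of D in A. Hence the trace of C in A is its trace
in a module of add D, where the property is inherited from D. -/
theorem TraceInAdd.trans (hCD : TraceInAdd Λ C D) (hCD' : LinearMap.id ∈ facMaps Λ D C C)
    (hDA : TraceInAdd Λ D A) : TraceInAdd Λ C A := by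
  have h1 : TraceInAdd Λ C (traceSubmodule Λ D A) := hCD.of_id_mem hDA
  have h2 : traceSubmodule Λ C A ≤ traceSubmodule Λ D A := by
    refine iSup_le fun f => range_le_traceSubmodule_of_mem ?_
    exact facMaps_le_of_id_mem hCD' (comp_mem_facMaps f LinearMap.id)
  have h3 : ∀ x : traceSubmodule Λ C A,
      Submodule.inclusion h2 x ∈ traceSubmodule Λ C (traceSubmodule Λ D A) := by
    rintro ⟨x, hx⟩
    have h4 : traceSubmodule Λ C A ≤ (traceSubmodule Λ C (traceSubmodule Λ D A)).map
        (traceSubmodule Λ D A).subtype := by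
      refine iSup_le fun f => ?_
      have hf : ∀ c, f c ∈ traceSubmodule Λ D A := fun c =>
        h2 (range_le_traceSubmodule f ⟨c, rfl⟩)
      rintro _ ⟨c, rfl⟩
      exact ⟨⟨f c, hf c⟩, range_le_traceSubmodule (f.codRestrict _ hf) ⟨c, rfl⟩, rfl⟩
    obtain ⟨y, hy, hyx⟩ := h4 hx
    rwa [show Submodule.inclusion h2 ⟨x, hx⟩ = y from Subtype.ext hyx.symm]
  exact facMaps_comp_left (facMaps_comp_right h1
    ((Submodule.inclusion h2).codRestrict _ h3)) (traceMap C (traceSubmodule Λ D A).subtype)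

theorem TraceInAdd.prod (hA : TraceInAdd Λ C A) (hB : TraceInAdd Λ C B) :
    TraceInAdd Λ C (A × B) := by
  have h1 := facMaps_comp_left (facMaps_comp_right hA (traceMap C (LinearMap.fst Λ A B)))
    (traceMap C (LinearMap.inl Λ A B))
  have h2 := facMaps_comp_left (facMaps_comp_right hB (traceMap C (LinearMap.snd Λ A B)))
    (traceMap C (LinearMap.inr Λ A B))
  rw [TraceInAdd]
  convert! add_mem h1 h2 using 1
  ext x <;> simp

end FactoringMaps

/-! ### The ideal of endomorphisms factoring through a summand -/

section FactoringIdeal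

variable (Λ : Type*) [Ring Λ]
variable (C : Type*) [AddCommGroup C] [Module Λ C]
variable (X : Type*) [AddCommGroup X] [Module Λ X]

/-- The two-sided ideal of sums of endomorphisms of `X` factoring through `C`. -/
def facIdeal : Ideal (RightEnd Λ X) where
  carrier := {γ | γ.unop ∈ facMaps Λ C X X}
  add_mem' := (facMaps Λ C X X).add_mem
  zero_mem' := (facMaps Λ C X X).zero_mem
  smul_mem' γ _ h := facMaps_comp_right h γ.unop

variable {Λ C X}

theorem mem_facIdeal {γ : RightEnd Λ X} : γ ∈ facIdeal Λ C X ↔ γ.unop ∈ facMaps Λ C X X :=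
  Iff.rfl

instance : (facIdeal Λ C X).IsTwoSided where
  mul_mem_of_left γ h := facMaps_comp_left h γ.unop

theorem facIdeal_mul_self (h : IsSummand Λ C X) :
    facIdeal Λ C X * facIdeal Λ C X = facIdeal Λ C X := by
  refine le_antisymm Ideal.mul_le_left fun γ hγ => ?_
  obtain ⟨i, p, hip⟩ := h
  rw [mem_facIdeal] at hγ
  suffices ∀ f ∈ facMaps Λ C X X, MulOpposite.op f ∈ facIdeal Λ C X * facIdeal Λ C X from
    this _ hγ
  intro f hf
  induction hf using AddSubgroup.closure_induction with
  | mem x hx =>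
    obtain ⟨g, f, rfl⟩ := hx
    have : f ∘ₗ g = (f ∘ₗ p) ∘ₗ (i ∘ₗ g) := by
      rw [LinearMap.comp_assoc, ← LinearMap.comp_assoc _ _ p, hip, LinearMap.id_comp]
    rw [this]
    exact Ideal.mul_mem_mul (r := MulOpposite.op (i ∘ₗ g)) (s := MulOpposite.op (f ∘ₗ p))
      (comp_mem_facMaps i g) (comp_mem_facMaps f p)
  | zero => exact zero_mem _
  | add x y _ _ hx hy => exact add_mem hx hy
  | neg x _ hx => exact neg_mem hx

/-- If `C` is a summand of `X`, then sums of maps factoring through `C` are sums of maps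
factoring through `X`. -/
theorem exists_sum_comp_eq_of_mem_facMaps {T : Type*} [AddCommGroup T] [Module Λ T] (h : IsSummand Λ C X)
    {t : T →ₗ[Λ] T} (ht : t ∈ facMaps Λ C T T) :
    ∃ (n : ℕ) (a : Fin n → X →ₗ[Λ] T) (b : Fin n → T →ₗ[Λ] X), ∑ k, a k ∘ₗ b k = t := by
  obtain ⟨i, p, hip⟩ := h
  induction ht using AddSubgroup.closure_induction with
  | mem x hx =>
    obtain ⟨g, f, rfl⟩ := hx
    refine ⟨1, fun _ => f ∘ₗ p, fun _ => i ∘ₗ g, ?_⟩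
    simp [LinearMap.comp_assoc, ← LinearMap.comp_assoc _ _ p, hip]
  | zero => exact ⟨0, 0, 0, by simp⟩
  | add x y _ _ hx hy =>
    obtain ⟨n, a, b, rfl⟩ := hx
    obtain ⟨m, c, d, rfl⟩ := hy
    exact ⟨n + m, Fin.append a c, Fin.append b d, by simp [Fin.sum_univ_add]⟩
  | neg x _ hx =>
    obtain ⟨n, a, b, rfl⟩ := hx
    exact ⟨n, fun k => -a k, b, by simp [LinearMap.neg_comp]⟩

/-- With T the trace of C in X, the ideal is Hom(X, T). Writing the identity of T as ∑ aₖ bₖ through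
X makes it a direct summand of a finite free module: bₖ gives the coordinates and aₖ the generators.
-/
theorem facIdeal_finite_projective (h : IsSummand Λ C X) (hT : TraceInAdd Λ C X) :
    Module.Finite (RightEnd Λ X) (facIdeal Λ C X) ∧
      Module.Projective (RightEnd Λ X) (facIdeal Λ C X) := by
  obtain ⟨n, a, b, hab⟩ := exists_sum_comp_eq_of_mem_facMaps h hT
  have ha : ∀ k, MulOpposite.op ((traceSubmodule Λ C X).subtype ∘ₗ a k) ∈ facIdeal Λ C X := by
    intro k
    have := facMaps_comp_left (facMaps_comp_right hT (a k)) (traceSubmodule Λ C X).subtype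
    exact this
  have hr : ∀ (γ : facIdeal Λ C X) (x : X), γ.1.unop x ∈ traceSubmodule Λ C X := fun γ x =>
    range_le_traceSubmodule_of_mem (mem_facIdeal.mp γ.2) ⟨x, rfl⟩
  let s : (Fin n → RightEnd Λ X) →ₗ[RightEnd Λ X] facIdeal Λ C X :=
    Fintype.linearCombination (RightEnd Λ X) (fun k => ⟨_, ha k⟩)
  let r : facIdeal Λ C X →ₗ[RightEnd Λ X] (Fin n → RightEnd Λ X) :=
    { toFun := fun γ k => MulOpposite.op (b k ∘ₗ γ.1.unop.codRestrict _ (hr γ))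
      map_add' := by
        intro γ γ'
        funext k
        apply MulOpposite.unop_injective
        ext x
        change b k _ = b k _ + b k _
        rw [← map_add]
        rfl
      map_smul' := fun _ _ => rfl }
  have hsr : s ∘ₗ r = LinearMap.id := by
    ext γ
    apply MulOpposite.unop_injective
    ext x
    have h1 := congrArg (fun f : traceSubmodule Λ C X →ₗ[Λ] traceSubmodule Λ C X =>
      (f ⟨γ.1.unop x, hr γ x⟩ : X)) hab
    simp only [LinearMap.coe_sum, Finset.sum_apply, LinearMap.id_apply] at h1
    simp only [s, r, LinearMap.comp_apply, Fintype.linearCombination_apply, LinearMap.id_apply]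
    rw [← h1]
    simp [Finset.unop_sum, LinearMap.sum_apply]
    rfl
  exact ⟨Module.Finite.of_surjective s fun γ => ⟨r γ, LinearMap.congr_fun hsr γ⟩,
    Module.Projective.of_split r s hsr⟩

end FactoringIdeal

/-! ### Heredity chains inside a ring and their images in quotients -/

section HeredityChains

variable {Γ : Type*} [Ring Γ]

/-- Conditions on ideals `I' ≤ I` of `Γ` which ensure that `I / I'` is a heredity ideal of
`Γ / I'`. -/
structure IsHeredityStep (I' I : Ideal Γ) : Prop where
  le : I' ≤ I
  isTwoSided' : I'.IsTwoSided
  isTwoSided : I.IsTwoSided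
  mul_self' : I' * I' = I'
  mul_self : I * I = I
  finite : Module.Finite Γ I
  projective : Module.Projective Γ I
  -- The condition on j says, by quasi-invertibility, that its class lies in the Jacobson radical of
  -- Γ / I'; it avoids forming that quotient.
  mul_mul_mem : ∀ a ∈ I, ∀ b ∈ I, ∀ j, (∀ y, ∃ z, z * y * j + z - 1 ∈ I') → a * j * b ∈ I'

/-- There is a finite chain of heredity steps from `I₀` up to `I`. -/
inductive HeredityChain (I₀ : Ideal Γ) : Ideal Γ → Prop
  | refl : I₀.IsTwoSided → HeredityChain I₀ I₀
  | step {I' I : Ideal Γ} : HeredityChain I₀ I' → IsHeredityStep I' I → HeredityChain I₀ I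

variable {A : Type*} [Ring A]

theorem Ideal.isTwoSided_map_of_surjective {I : Ideal Γ} (hI : I.IsTwoSided)
    (ψ : Γ →+* A) (hψ : Function.Surjective ψ) : (I.map ψ).IsTwoSided := by
  refine ⟨fun {a} b ha => ?_⟩
  obtain ⟨x, hx, rfl⟩ := (Ideal.mem_map_iff_of_surjective ψ hψ).mp ha
  obtain ⟨y, rfl⟩ := hψ b
  rw [← map_mul]
  exact Ideal.mem_map_of_mem ψ (I.mul_mem_right _ hx)

/-- Idempotency of I' is essential: every element of I' is a sum of products m n with m ∈ I' and n ∈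
I' ⊆ I, so a linear map I → Γⁿ sends I' into I'ⁿ. A splitting of Γⁿ → I therefore descends modulo
I'. -/
theorem IsHeredityStep.finite_projective_map {I' I : Ideal Γ} (h : IsHeredityStep I' I)
    (ψ : Γ →+* A) (hψ : Function.Surjective ψ) (hker : RingHom.ker ψ = I') :
    Module.Finite A (I.map ψ) ∧ Module.Projective A (I.map ψ) := by
  have := h.finite
  have := h.projective
  obtain ⟨n, s, r, -, -, hsr⟩ := Module.Finite.exists_comp_eq_id_of_projective Γ I
  have hsr' : ∀ x, s (r x) = x := LinearMap.congr_fun hsr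
  have hmem : ∀ y : I.map ψ, ∃ x : I, ψ x = y := fun y => by
    obtain ⟨x, hx, hxy⟩ := (Ideal.mem_map_iff_of_surjective ψ hψ).mp y.2
    exact ⟨⟨x, hx⟩, hxy⟩
  choose c hc using hmem
  have hI' : ∀ x : I, (x : Γ) ∈ I' → ∀ k, r x k ∈ I' := by
    have := h.isTwoSided'
    rintro ⟨x, hxI⟩ hx k
    change x ∈ I' at hx
    rw [← h.mul_self'] at hx
    obtain ⟨hz, hr⟩ : ∃ hz : x ∈ I, r ⟨x, hz⟩ k ∈ I' := by
      refine Submodule.mul_induction_on hx ?_ ?_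
      · intro m hm n hn
        refine ⟨I.mul_mem_left _ (h.le hn), ?_⟩
        have : (⟨m * n, I.mul_mem_left _ (h.le hn)⟩ : I) = m • ⟨n, h.le hn⟩ := rfl
        rw [this, map_smul]
        exact I'.mul_mem_right _ hm
      · rintro x y ⟨hx, hrx⟩ ⟨hy, hry⟩
        refine ⟨add_mem hx hy, ?_⟩
        have : (⟨x + y, add_mem hx hy⟩ : I) = ⟨x, hx⟩ + ⟨y, hy⟩ := rfl
        rw [this, map_add]
        exact add_mem hrx hry
    exact hr
  have hwd : ∀ x y : I, ψ x = ψ y → ∀ k, ψ (r x k) = ψ (r y k) := by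
    intro x y hxy k
    rw [← sub_eq_zero, ← map_sub, ← RingHom.mem_ker, hker] at hxy ⊢
    have := hI' (x - y) hxy k
    rwa [map_sub] at this
  let r' : I.map ψ →ₗ[A] (Fin n → A) :=
    { toFun := fun y k => ψ (r (c y) k)
      map_add' := fun y y' => by
        funext k
        rw [Pi.add_apply, ← map_add, ← Pi.add_apply, ← map_add]
        exact hwd _ _ (by simp [hc]) k
      map_smul' := fun a y => by
        funext k
        obtain ⟨γ, rfl⟩ := hψ a
        rw [Pi.smul_apply, smul_eq_mul, RingHom.id_apply, ← map_mul, ← smul_eq_mul, ← Pi.smul_apply,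
          ← map_smul]
        exact hwd _ _ (by simp [hc]) k }
  let s' : (Fin n → A) →ₗ[A] I.map ψ :=
    Fintype.linearCombination A (fun k => ⟨ψ (s fun j => if k = j then 1 else 0), Ideal.mem_map_of_mem ψ (s _).2⟩)
  have hsr'' : s' ∘ₗ r' = LinearMap.id := by
    ext y
    simp only [s', r', LinearMap.comp_apply, Fintype.linearCombination_apply, LinearMap.id_apply,
      LinearMap.coe_mk, AddHom.coe_mk]
    rw [← hc y]
    conv_rhs => rw [← hsr' (c y), LinearMap.pi_apply_eq_sum_univ s]
    simp
  exact ⟨Module.Finite.of_surjective s' fun γ => ⟨r' γ, LinearMap.congr_fun hsr'' γ⟩,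
    Module.Projective.of_split r' s' hsr''⟩

theorem IsHeredityStep.isHeredityIdeal {I' I : Ideal Γ} (h : IsHeredityStep I' I)
    (ψ : Γ →+* A) (hψ : Function.Surjective ψ) (hker : RingHom.ker ψ = I') :
    IsHeredityIdeal (I.map ψ) := by
  have hI := h.isTwoSided
  have hmem : ∀ y, y ∈ I.map ψ ↔ ∃ x ∈ I, ψ x = y := fun y =>
    Ideal.mem_map_iff_of_surjective ψ hψ
  have hI2 := Ideal.isTwoSided_map_of_surjective hI ψ hψ
  refine ⟨hI2, ?_, ?_, (h.finite_projective_map ψ hψ hker).1,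
    (h.finite_projective_map ψ hψ hker).2⟩
  · refine le_antisymm Ideal.mul_le_left ?_
    conv_lhs => rw [← h.mul_self]
    rw [Ideal.map_le_iff_le_comap]
    intro z hz
    refine Submodule.mul_induction_on hz ?_ ?_
    · intro m hm n hn
      rw [Ideal.mem_comap, map_mul]
      exact Ideal.mul_mem_mul (Ideal.mem_map_of_mem ψ hm) (Ideal.mem_map_of_mem ψ hn)
    · exact fun _ _ => add_mem
  · rw [eq_bot_iff, Ideal.mul_le]
    intro r hr b hb
    obtain ⟨y, hy, rfl⟩ := (hmem _).mp hb
    have key : ∀ a ∈ I, ∀ j ∈ Ring.jacobson A, ψ a * j * ψ y = 0 := by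
      intro a ha j hj
      obtain ⟨j, rfl⟩ := hψ j
      rw [← map_mul, ← map_mul, ← RingHom.mem_ker, hker]
      refine h.mul_mul_mem a ha y hy j fun t => ?_
      rw [← Ideal.jacobson_bot, Ideal.mem_jacobson_iff] at hj
      obtain ⟨z, hz⟩ := hj (ψ t)
      obtain ⟨z, rfl⟩ := hψ z
      refine ⟨z, ?_⟩
      rw [← hker, RingHom.mem_ker]
      simpa using hz
    refine Submodule.mul_induction_on hr ?_ ?_
    · intro m hm j hj
      obtain ⟨x, hx, rfl⟩ := (hmem _).mp hm
      exact key x hx j hj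
    · intro x y hx hy
      rw [add_mul]
      exact add_mem hx hy

theorem HeredityChain.exists_seq {I₀ I : Ideal Γ} (h : HeredityChain I₀ I) :
    ∃ (m : ℕ) (F : ℕ → Ideal Γ), F 0 = I ∧ F m = I₀ ∧ (∀ n, (F n).IsTwoSided ∧ I₀ ≤ F n) ∧
      ∀ n < m, IsHeredityStep (F (n + 1)) (F n) := by
  induction h with
  | refl h => exact ⟨0, fun _ => I₀, rfl, rfl, fun _ => ⟨h, le_rfl⟩, by simp⟩
  | @step I' I _ hI ih =>
    obtain ⟨m, F, h0, hm, hF, hs⟩ := ih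
    refine ⟨m + 1, fun n => Nat.casesOn n I F, rfl, hm, ?_, ?_⟩
    · rintro (_ | n)
      · exact ⟨hI.isTwoSided, ((hF 0).2.trans_eq h0).trans hI.le⟩
      · exact hF n
    · rintro (_ | n) hn
      · change IsHeredityStep (F 0) I
        rwa [h0]
      · exact hs n (by omega)

theorem HeredityChain.hasHeredityChain {I₀ : Ideal Γ} (h : HeredityChain I₀ ⊤)
    (ψ : Γ →+* A) (hψ : Function.Surjective ψ) (hker : RingHom.ker ψ = I₀) :
    HasHeredityChain A := by
  obtain ⟨m, F, h0, hm, hF, hs⟩ := h.exists_seq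
  have htwo : ∀ n, ((F n).map ψ).IsTwoSided := fun n =>
    Ideal.isTwoSided_map_of_surjective (hF n).1 ψ hψ
  refine ⟨m, fun n => (F n).map ψ, htwo, ?_, ?_, fun n hn => ⟨Ideal.map_mono (hs n hn).le, ?_⟩⟩
  · simp only [h0, Ideal.map_top]
  · simp only [hm]
    rw [eq_bot_iff, Ideal.map_le_iff_le_comap, ← hker]
    exact fun x hx => hx
  · rw [Ideal.map_map]
    refine (hs n hn).isHeredityIdeal _ (Ideal.Quotient.mk_surjective.comp hψ) ?_
    ext x
    rw [RingHom.mem_ker, RingHom.comp_apply, Ideal.Quotient.eq_zero_iff_mem,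
      Ideal.mem_map_iff_of_surjective ψ hψ]
    constructor
    · rintro ⟨y, hy, hyx⟩
      rw [← sub_add_cancel x y]
      refine add_mem ((hF (n + 1)).2 ?_) hy
      rw [← hker, RingHom.mem_ker, map_sub, hyx, sub_self]
    · exact fun hx => ⟨x, hx, rfl⟩

end HeredityChains

/-! ### One heredity step, from semisimplicity of End(L) modulo its radical -/

section SemisimpleTop

variable {Λ : Type v} [Ring Λ]
variable {C : Type*} [AddCommGroup C] [Module Λ C]
variable {L : Type*} [AddCommGroup L] [Module Λ L]
variable {A B : Type*} [AddCommGroup A] [Module Λ A] [AddCommGroup B] [Module Λ B]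

theorem facMaps_of_range_le {h : A →ₗ[Λ] B} {S : Submodule Λ B} (hS : LinearMap.range h ≤ S)
    (hC : LinearMap.id ∈ facMaps Λ C S S) : h ∈ facMaps Λ C A B :=
  facMaps_comp_left (facMaps_comp_right hC (h.codRestrict S fun a => hS ⟨a, rfl⟩)) S.subtype

theorem exists_facMaps_traceSubmodule {h : A →ₗ[Λ] B} (hh : h ∈ facMaps Λ C A B) :
    ∃ h' ∈ facMaps Λ C A (traceSubmodule Λ C B), (traceSubmodule Λ C B).subtype ∘ₗ h' = h := by
  induction hh using AddSubgroup.closure_induction with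
  | mem x hx =>
    obtain ⟨g, f, rfl⟩ := hx
    exact ⟨_, comp_mem_facMaps (f.codRestrict _ fun c => range_le_traceSubmodule f ⟨c, rfl⟩) g, rfl⟩
  | zero => exact ⟨0, zero_mem _, by simp⟩
  | add x y _ _ hx hy =>
    obtain ⟨x, hx, rfl⟩ := hx
    obtain ⟨y, hy, rfl⟩ := hy
    exact ⟨x + y, add_mem hx hy, LinearMap.comp_add _ _ _⟩
  | neg x _ hx =>
    obtain ⟨x, hx, rfl⟩ := hx
    exact ⟨-x, neg_mem hx, LinearMap.comp_neg _ _⟩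

theorem jacobson_le_facIdeal {L' : Submodule Λ L}
    (hJ : ∀ j ∈ Ring.jacobson (RightEnd Λ L), LinearMap.range j.unop ≤ L')
    (hL' : LinearMap.id ∈ facMaps Λ C L' L') :
    Ring.jacobson (RightEnd Λ L) ≤ facIdeal Λ C L :=
  fun j hj => facMaps_of_range_le (hJ j hj) hL'

/-- The image of I in the semisimple quotient is generated by an idempotent; ε is any lift in I, not
necessarily idempotent itself. -/
theorem exists_sub_mul_mem_of_isSemisimpleRing {Γ : Type*} [Ring Γ] (J I : Ideal Γ)
    [J.IsTwoSided] [IsSemisimpleRing (Γ ⧸ J)] : ∃ ε ∈ I, ∀ a ∈ I, a - a * ε ∈ J := by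
  obtain ⟨e, he, hI⟩ := IsSemisimpleRing.ideal_eq_span_idempotent (I.map (Ideal.Quotient.mk J))
  have hmem : e ∈ I.map (Ideal.Quotient.mk J) := hI ▸ Ideal.mem_span_singleton_self e
  obtain ⟨ε, hε, rfl⟩ :=
    (Ideal.mem_map_iff_of_surjective _ Ideal.Quotient.mk_surjective).mp hmem
  refine ⟨ε, hε, fun a ha => ?_⟩
  have h1 : Ideal.Quotient.mk J a ∈ Ideal.span {Ideal.Quotient.mk J ε} :=
    hI ▸ Ideal.mem_map_of_mem _ ha
  obtain ⟨x, hx⟩ := Ideal.mem_span_singleton'.mp h1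
  rw [← Ideal.Quotient.eq_zero_iff_mem, map_sub, map_mul, ← hx, mul_assoc, he.eq, sub_self]

theorem mem_of_isSemisimpleRing_of_jacobson {Γ : Type*} [Ring Γ] {J I : Ideal Γ}
    [J.IsTwoSided] [I.IsTwoSided] [IsSemisimpleRing (Γ ⧸ J)] (hJI : J ≤ I) {h : Γ}
    (hh : ∀ y, ∃ z, z * y * h + z - 1 ∈ I) : h ∈ I := by
  have : IsSemisimpleRing (Γ ⧸ I) :=
    (Ideal.Quotient.factor hJI).isSemisimpleRing_of_surjective
      (Ideal.Quotient.factor_surjective hJI)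
  rw [← Ideal.Quotient.eq_zero_iff_mem, ← Ideal.mem_bot, ← IsSemisimpleRing.jacobson_eq_bot (Γ ⧸ I),
    ← Ideal.jacobson_bot, Ideal.mem_jacobson_iff]
  intro y
  obtain ⟨y, rfl⟩ := Ideal.Quotient.mk_surjective y
  obtain ⟨z, hz⟩ := hh y
  refine ⟨Ideal.Quotient.mk I z, ?_⟩
  rw [Ideal.mem_bot]
  simpa using Ideal.Quotient.eq_zero_iff_mem.mpr hz

/-- Since L generates C, the trace T of C in L is spanned by images of endomorphisms through C. For
ε as above, 1 - ε carries these images into L·J ⊆ L'. So on T the identity is ε, which factors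
through C, plus 1 - ε, which factors through L'. -/
theorem traceInAdd_of_jacobson_range_le {L' : Submodule Λ L}
    [IsSemisimpleRing (RightEnd Λ L ⧸ Ring.jacobson (RightEnd Λ L))]
    (hJ : ∀ j ∈ Ring.jacobson (RightEnd Λ L), LinearMap.range j.unop ≤ L')
    (hL' : LinearMap.id ∈ facMaps Λ C L' L') (hgen : traceSubmodule Λ L C = ⊤) :
    TraceInAdd Λ C L := by
  obtain ⟨ε, hε, hεa⟩ := exists_sub_mul_mem_of_isSemisimpleRing (Ring.jacobson (RightEnd Λ L))
    (facIdeal Λ C L)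
  have hL'T : L' ≤ traceSubmodule Λ C L := fun x hx =>
    range_le_traceSubmodule_of_mem (facMaps_comp_left hL' L'.subtype) ⟨⟨x, hx⟩, rfl⟩
  have hT : traceSubmodule Λ C L ≤ L'.comap (LinearMap.id - ε.unop) := by
    refine iSup_le fun f => ?_
    rw [LinearMap.range_eq_map, ← hgen, traceSubmodule, Submodule.map_iSup]
    refine iSup_le fun g => ?_
    rintro _ ⟨_, ⟨x, rfl⟩, rfl⟩
    exact hJ _ (hεa (MulOpposite.op (f ∘ₗ g)) (comp_mem_facMaps f g)) ⟨x, rfl⟩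
  obtain ⟨ε', hε', hεε'⟩ := exists_facMaps_traceSubmodule (mem_facIdeal.mp hε)
  have h1 := facMaps_comp_right hε' (traceSubmodule Λ C L).subtype
  have h2 := facMaps_comp_left (facMaps_comp_right hL'
    ((LinearMap.id - ε.unop).restrict (p := traceSubmodule Λ C L) hT)) (Submodule.inclusion hL'T)
  rw [TraceInAdd]
  convert! add_mem h1 h2 using 1
  ext x
  have := LinearMap.congr_fun hεε' x
  simp only [LinearMap.comp_apply, Submodule.subtype_apply] at this
  simp [this]

/-- Of the four matrix entries of h, all but the one from L to L factor through C trivially. -/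
theorem mem_facMaps_prod {h : L × C →ₗ[Λ] L × C}
    (hh : LinearMap.fst Λ L C ∘ₗ h ∘ₗ LinearMap.inl Λ L C ∈ facMaps Λ C L L) :
    h ∈ facMaps Λ C (L × C) (L × C) := by
  have h1 := facMaps_comp_left (facMaps_comp_right hh (LinearMap.fst Λ L C)) (LinearMap.inl Λ L C)
  have h2 := comp_mem_facMaps (h ∘ₗ LinearMap.inr Λ L C) (LinearMap.snd Λ L C)
  have h3 := comp_mem_facMaps (LinearMap.inr Λ L C)
    (LinearMap.snd Λ L C ∘ₗ h ∘ₗ LinearMap.inl Λ L C ∘ₗ LinearMap.fst Λ L C)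
  convert! add_mem (add_mem h1 h2) h3 using 1
  have h0 : h (0, 0) = 0 := map_zero h
  ext x <;> simp [h0]

theorem comp_mem_facMaps_prod {X : Type*} [AddCommGroup X] [Module Λ X]
    [IsSemisimpleRing (RightEnd Λ L ⧸ Ring.jacobson (RightEnd Λ L))]
    (hJ : Ring.jacobson (RightEnd Λ L) ≤ facIdeal Λ C L) {j : RightEnd Λ X}
    (hj : ∀ y, ∃ z, z * y * j + z - 1 ∈ facIdeal Λ C X)
    (u : L × C →ₗ[Λ] X) (v : X →ₗ[Λ] L × C) :
    v ∘ₗ j.unop ∘ₗ u ∈ facMaps Λ C (L × C) (L × C) := by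
  refine mem_facMaps_prod ?_
  set u' := u ∘ₗ LinearMap.inl Λ L C
  set v' := LinearMap.fst Λ L C ∘ₗ v
  change (MulOpposite.op (v' ∘ₗ j.unop ∘ₗ u')) ∈ facIdeal Λ C L
  refine mem_of_isSemisimpleRing_of_jacobson hJ fun y => ?_
  obtain ⟨z, hz⟩ := hj (MulOpposite.op (u' ∘ₗ y.unop ∘ₗ v'))
  set s := j.unop ∘ₗ u' ∘ₗ y.unop
  -- If z is a left inverse of 1 + ba, then 1 - a z b is a left inverse of 1 + ab; here this is used
  -- modulo maps through C.
  refine ⟨MulOpposite.op (LinearMap.id - v' ∘ₗ z.unop ∘ₗ s), ?_⟩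
  have := neg_mem (facMaps_comp_left (facMaps_comp_right (mem_facIdeal.mp hz) s) v')
  rw [mem_facIdeal]
  convert! this using 1
  ext x
  simp [s]
  abel

theorem isHeredityStep_facIdeal_prod {X : Type*} [AddCommGroup X] [Module Λ X]
    [IsSemisimpleRing (RightEnd Λ L ⧸ Ring.jacobson (RightEnd Λ L))]
    (hJ : Ring.jacobson (RightEnd Λ L) ≤ facIdeal Λ C L)
    (hX : IsSummand Λ (L × C) X) (hT : TraceInAdd Λ (L × C) X) :
    IsHeredityStep (facIdeal Λ C X) (facIdeal Λ (L × C) X) where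
  le := fun _ h => facMaps_le_of_id_mem IsSummand.prod_right.id_mem h
  isTwoSided' := inferInstance
  isTwoSided := inferInstance
  mul_self' := facIdeal_mul_self (IsSummand.prod_right.trans hX)
  mul_self := facIdeal_mul_self hX
  finite := (facIdeal_finite_projective hX hT).1
  projective := (facIdeal_finite_projective hX hT).2
  mul_mul_mem a ha b hb j hj := by
    change b.unop ∘ₗ j.unop ∘ₗ a.unop ∈ facMaps Λ C X X
    rw [mem_facIdeal] at ha hb
    generalize a.unop = a at ha
    generalize b.unop = b at hb
    induction ha using AddSubgroup.closure_induction with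
    | mem a ha =>
      obtain ⟨g, f, rfl⟩ := ha
      induction hb using AddSubgroup.closure_induction with
      | mem b hb =>
        obtain ⟨g', f', rfl⟩ := hb
        exact facMaps_comp_left (facMaps_comp_right (comp_mem_facMaps_prod hJ hj f g') g) f'
      | zero => simp [zero_mem]
      | add x y _ _ hx hy => rw [LinearMap.add_comp]; exact add_mem hx hy
      | neg x _ hx => rw [LinearMap.neg_comp]; exact neg_mem hx
    | zero => simp [zero_mem]
    | add x y _ _ hx hy => simp only [LinearMap.comp_add]; exact add_mem hx hy
    | neg x _ hx => simp only [LinearMap.comp_neg]; exact neg_mem hx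

end SemisimpleTop

/-! ### The inductive construction, and the theorem for artin algebras -/

section Induction

variable {R : Type u} [CommRing R] {Λ : Type v} [Ring Λ] [Algebra R Λ]

/-- `L` can be completed to a module `L × N` which is the top of a sequence of modules ending in
`B`, such that the endomorphism ring of each module `X` whose trace is built from `L × N` has a
heredity chain between the ideals given by `B` and by `L × N`. -/
def HasHeredityCompletion (Λ : Type v) [Ring Λ] [Algebra R Λ] (ϖ : R) (B L : Type w)
    [AddCommGroup B] [Module R B] [Module Λ B] [IsScalarTower R Λ B]
    [AddCommGroup L] [Module R L] [Module Λ L] [IsScalarTower R Λ L] : Prop :=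
  ∃ (N : Type w) (_ : AddCommGroup N) (_ : Module R N) (_ : Module Λ N) (_ : IsScalarTower R Λ N),
    Module.Finite R N ∧ (Module.IsTorsionFree R L → Module.IsTorsionFree R N) ∧
    traceSubmodule Λ L (L × N) = ⊤ ∧ IsSummand Λ B (L × N) ∧
    -- For orders this bounds the quotient by the maps through B. For artin algebras ϖ = 0 and the
    -- clause is void.
    (∃ n : ℕ, ϖ ^ n • (LinearMap.id : L × N →ₗ[Λ] L × N) ∈ facMaps Λ B (L × N) (L × N)) ∧
    -- X is arbitrary so that the chain can be reused in the endomorphism ring of the larger module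
    -- of each further step.
    ∀ (X : Type w) [AddCommGroup X] [Module Λ X], IsSummand Λ (L × N) X →
      TraceInAdd Λ (L × N) X → HeredityChain (facIdeal Λ B X) (facIdeal Λ (L × N) X)

theorem HasHeredityCompletion.refl (ϖ : R) (B : Type w) [AddCommGroup B] [Module R B] [Module Λ B]
    [IsScalarTower R Λ B] : HasHeredityCompletion Λ ϖ B B := by
  have hid : LinearMap.id ∈ facMaps Λ B (B × PUnit.{w + 1}) (B × PUnit.{w + 1}) := by
    have := comp_mem_facMaps (LinearMap.inl Λ B PUnit.{w + 1}) (LinearMap.fst Λ B PUnit.{w + 1})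
    convert! this using 1
  refine ⟨PUnit, inferInstance, inferInstance, inferInstance, inferInstance, inferInstance,
    fun _ => inferInstance, traceSubmodule_eq_top_of_id_mem hid, IsSummand.prod_left,
    ⟨0, by simpa using hid⟩, fun X _ _ _ _ => ?_⟩
  have : facIdeal Λ (B × PUnit.{w + 1}) X = facIdeal Λ B X :=
    le_antisymm (fun _ h => facMaps_le_of_id_mem hid h)
      (fun _ h => facMaps_le_of_id_mem IsSummand.prod_left.id_mem h)
  rw [this]
  exact .refl inferInstance

theorem smul_comp_mem_facMaps {B C A D : Type*} [AddCommGroup B] [Module Λ B]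
    [AddCommGroup C] [Module R C] [Module Λ C] [IsScalarTower R Λ C]
    [AddCommGroup A] [Module Λ A]
    [AddCommGroup D] [Module R D] [Module Λ D] [IsScalarTower R Λ D] {r : R}
    (hr : r • LinearMap.id ∈ facMaps Λ B C C) {h : A →ₗ[Λ] D} (hh : h ∈ facMaps Λ C A D) :
    r • h ∈ facMaps Λ B A D := by
  induction hh using AddSubgroup.closure_induction with
  | mem x hx =>
    obtain ⟨g, f, rfl⟩ := hx
    have := facMaps_comp_left (facMaps_comp_right hr g) f
    convert! this using 1
    ext x
    simp [LinearMap.map_smul_of_tower]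
  | zero => simp [zero_mem]
  | add x y _ _ hx hy => rw [smul_add]; exact add_mem hx hy
  | neg x _ hx => rw [smul_neg]; exact neg_mem hx

theorem HasHeredityCompletion.step [IsNoetherianRing R] (ϖ : R) {B L : Type w}
    [AddCommGroup B] [Module R B] [Module Λ B] [IsScalarTower R Λ B]
    [AddCommGroup L] [Module R L] [Module Λ L] [IsScalarTower R Λ L] [Module.Finite R L]
    [IsSemisimpleRing (RightEnd Λ L ⧸ Ring.jacobson (RightEnd Λ L))] (L' : Submodule Λ L)
    (hJ : ∀ j ∈ Ring.jacobson (RightEnd Λ L), LinearMap.range j.unop ≤ L')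
    (hϖ : ∀ x : L, ϖ • x ∈ L') (hgen : traceSubmodule Λ L L' = ⊤)
    (h : HasHeredityCompletion Λ ϖ B L') : HasHeredityCompletion Λ ϖ B L := by
  obtain ⟨N, _, _, _, _, hfin, htf, hgen', hB, ⟨n, hn⟩, hX⟩ := h
  have hL' : LinearMap.id ∈ facMaps Λ (L' × N) L' L' := IsSummand.prod_left.id_mem
  have hgenC : traceSubmodule Λ L (L' × N) = ⊤ := traceSubmodule_eq_top_trans hgen hgen'
  have : Module.Finite R L' :=
    inferInstanceAs (Module.Finite R (L'.restrictScalars R))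
  refine ⟨L' × N, inferInstance, inferInstance, inferInstance, inferInstance, inferInstance, ?_,
    ?_, hB.trans IsSummand.prod_right, ⟨n + 1, ?_⟩, ?_⟩
  · intro hL
    have : Module.IsTorsionFree R L' :=
      inferInstanceAs (Module.IsTorsionFree R (L'.restrictScalars R))
    have := htf this
    infer_instance
  · exact traceSubmodule_prod_eq_top
      (traceSubmodule_eq_top_of_id_mem IsSummand.refl.id_mem) hgenC
  · have h1 : ϖ • (LinearMap.id : L →ₗ[Λ] L) ∈ facMaps Λ (L' × N) L L := by
      refine facMaps_of_range_le (S := L') ?_ hL'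
      rintro _ ⟨x, rfl⟩
      exact hϖ x
    have h2 := facMaps_comp_left (facMaps_comp_right h1 (LinearMap.fst Λ L (L' × N)))
      (LinearMap.inl Λ L (L' × N))
    have h3 := comp_mem_facMaps (ϖ • LinearMap.inr Λ L (L' × N)) (LinearMap.snd Λ L (L' × N))
    have h4 : ϖ • LinearMap.id ∈ facMaps Λ (L' × N) (L × L' × N) (L × L' × N) := by
      convert! add_mem h2 h3 using 1
      ext x <;> simp
    rw [pow_succ, mul_smul]
    exact smul_comp_mem_facMaps hn h4
  · intro X _ _ hs hT
    -- By transitivity the trace condition for X passes to C = L' × N, so the chain already built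
    -- for C is available below the new step.
    have hC : TraceInAdd Λ (L' × N) (L × L' × N) :=
      (traceInAdd_of_jacobson_range_le hJ hL' hgenC).prod .self
    exact .step (hX X (IsSummand.prod_right.trans hs)
      (hC.trans IsSummand.prod_right.id_mem hT))
      (isHeredityStep_facIdeal_prod (jacobson_le_facIdeal hJ hL') hs hT)

/-- The submodule of `L` generated by the images of the endomorphisms in a left ideal. -/
def idealRange {L : Type w} [AddCommGroup L] [Module Λ L] (I : Ideal (RightEnd Λ L)) :
    Submodule Λ L :=
  ⨆ b : I, LinearMap.range b.1.unop

section

variable {L : Type w} [AddCommGroup L] [Module Λ L]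

theorem range_le_idealRange {I : Ideal (RightEnd Λ L)} {b : RightEnd Λ L} (hb : b ∈ I) :
    LinearMap.range b.unop ≤ idealRange I :=
  le_iSup (fun b : I => LinearMap.range b.1.unop) ⟨b, hb⟩

theorem idealRange_le {I : Ideal (RightEnd Λ L)} {S : Submodule Λ L} :
    idealRange I ≤ S ↔ ∀ b ∈ I, LinearMap.range b.unop ≤ S := by
  simp [idealRange]

theorem traceSubmodule_idealRange (I : Ideal (RightEnd Λ L)) :
    traceSubmodule Λ L (idealRange I) = ⊤ := by
  rw [eq_top_iff]
  rintro ⟨x, hx⟩ -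
  have h : idealRange I ≤ (traceSubmodule Λ L (idealRange I)).map (idealRange I).subtype := by
    rw [idealRange_le]
    rintro b hb _ ⟨y, rfl⟩
    have hb' : ∀ y, b.unop y ∈ idealRange I := fun y => range_le_idealRange hb ⟨y, rfl⟩
    exact ⟨⟨b.unop y, hb' y⟩, range_le_traceSubmodule (b.unop.codRestrict _ hb') ⟨y, rfl⟩, rfl⟩
  obtain ⟨y, hy, hyx⟩ := h hx
  rwa [show (⟨x, hx⟩ : idealRange I) = y from Subtype.ext hyx.symm]

theorem idealRange_mul_eq_top {I J : Ideal (RightEnd Λ L)} (hI : idealRange I = ⊤)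
    (hJ : idealRange J = ⊤) : idealRange (I * J) = ⊤ := by
  rw [eq_top_iff, ← hJ, idealRange_le]
  intro b hb
  rw [LinearMap.range_eq_map, ← hI, idealRange, Submodule.map_iSup]
  refine iSup_le fun a => ?_
  rw [← LinearMap.range_comp]
  exact range_le_idealRange (b := a.1 * b) (Ideal.mul_mem_mul a.2 hb)

/-- L·J = L implies L·Jⁿ = L for all n. -/
theorem subsingleton_of_idealRange_eq_top {J : Ideal (RightEnd Λ L)} (hJ : IsNilpotent J)
    (h : idealRange J = ⊤) : Subsingleton L := by
  obtain ⟨n, hn⟩ := hJ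
  have key : ∀ n : ℕ, idealRange (J ^ n) = ⊤ := by
    intro n
    induction n with
    | zero =>
      rw [eq_top_iff, Submodule.pow_zero, Ideal.one_eq_top]
      exact fun x _ => range_le_idealRange (b := (1 : RightEnd Λ L)) (by simp) ⟨x, rfl⟩
    | succ n ih => rw [Submodule.pow_succ]; exact idealRange_mul_eq_top ih h
  have h0 := key n
  rw [hn] at h0
  refine subsingleton_of_forall_eq 0 fun x => ?_
  have h1 : idealRange (0 : Ideal (RightEnd Λ L)) ≤ ⊥ := by
    rw [idealRange_le]
    rintro b hb _ ⟨y, rfl⟩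
    rw [show b = 0 from hb]
    simp
  exact (Submodule.mem_bot Λ).mp (h1 (h0 ▸ Submodule.mem_top))

end

theorem finite_rightEnd [IsNoetherianRing R] (L : Type w) [AddCommGroup L] [Module R L]
    [Module Λ L] [IsScalarTower R Λ L] [Module.Finite R L] : Module.Finite R (RightEnd Λ L) := by
  have : Module.Finite R (Module.End Λ L) :=
    Module.Finite.of_injective (LinearMap.restrictScalarsₗ R Λ L L R)
      (LinearMap.restrictScalars_injective R)
  exact Module.Finite.equiv (MulOpposite.opLinearEquiv R)

theorem exists_hasHeredityCompletion_of_isArtinianRing [IsArtinianRing R] (M : Type w)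
    [AddCommGroup M] [Module R M] [Module Λ M] [IsScalarTower R Λ M] [Module.Finite R M] :
    ∃ (B : Type w) (_ : AddCommGroup B) (_ : Module R B) (_ : Module Λ B)
      (_ : IsScalarTower R Λ B), Subsingleton B ∧ HasHeredityCompletion Λ (0 : R) B M := by
  have : IsArtinian Λ M := isArtinian_of_tower R inferInstance
  -- The induction runs over submodules of the artinian module M, with L an abstract copy of S.
  suffices ∀ (S : Submodule Λ M) (L : Type w) [AddCommGroup L] [Module R L] [Module Λ L]
      [IsScalarTower R Λ L] [Module.Finite R L] (ι : L →ₗ[Λ] M), Function.Injective ι →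
      LinearMap.range ι = S → ∃ (B : Type w) (_ : AddCommGroup B) (_ : Module R B)
      (_ : Module Λ B) (_ : IsScalarTower R Λ B),
      Subsingleton B ∧ HasHeredityCompletion Λ (0 : R) B L from
    this _ M LinearMap.id Function.injective_id rfl
  intro S
  induction S using WellFoundedLT.induction with
  | ind S ih =>
    intro L _ _ _ _ _ ι hι hS
    by_cases hL : Subsingleton L
    · exact ⟨L, inferInstance, inferInstance, inferInstance, inferInstance, hL, .refl 0 L⟩
    have := finite_rightEnd (R := R) (Λ := Λ) L
    have : IsArtinianRing (RightEnd Λ L) := IsArtinianRing.of_finite R _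
    set J := Ring.jacobson (RightEnd Λ L)
    have hJ : IsNilpotent J := IsSemiprimaryRing.isNilpotent
    have : Module.Finite R (idealRange J) :=
      inferInstanceAs (Module.Finite R ((idealRange J).restrictScalars R))
    obtain ⟨B, _, _, _, _, hB, hBL⟩ := ih (LinearMap.range (ι ∘ₗ (idealRange J).subtype)) (by
      rw [← hS, LinearMap.range_comp, Submodule.range_subtype, LinearMap.range_eq_map]
      refine Submodule.map_strictMono_of_injective hι (lt_top_iff_ne_top.mpr fun h => hL ?_)
      exact subsingleton_of_idealRange_eq_top hJ h) (idealRange J) (ι ∘ₗ (idealRange J).subtype)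
      (hι.comp (Submodule.subtype_injective _)) rfl
    exact ⟨B, inferInstance, inferInstance, inferInstance, inferInstance, hB,
      HasHeredityCompletion.step 0 (idealRange J) (fun j hj => range_le_idealRange hj)
      (by simp) (traceSubmodule_idealRange J) hBL⟩

theorem exists_isQuasiHereditaryAlgebra [IsArtinianRing R] (M : Type w)
    [AddCommGroup M] [Module R M] [Module Λ M] [IsScalarTower R Λ M] [Module.Finite R M] :
    ∃ (N : Type w) (_ : AddCommGroup N) (_ : Module R N) (_ : Module Λ N)
        (_ : IsScalarTower R Λ N),
        Module.Finite Λ N ∧ IsQuasiHereditaryAlgebra R (RightEnd Λ (M × N)) := by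
  obtain ⟨B, _, _, _, _, hB, N, _, _, _, _, hN, -, -, -, -, hX⟩ :=
    exists_hasHeredityCompletion_of_isArtinianRing (R := R) (Λ := Λ) M
  refine ⟨N, inferInstance, inferInstance, inferInstance, inferInstance,
    Module.Finite.of_restrictScalars_finite R Λ N, ?_, ?_⟩
  · have := finite_rightEnd (R := R) (Λ := Λ) (M × N)
    exact isFiniteLength_iff_isNoetherian_isArtinian.mpr ⟨inferInstance, inferInstance⟩
  · have h := hX (M × N) .refl .self
    have htop : facIdeal Λ (M × N) (M × N) = ⊤ :=
      (Ideal.eq_top_iff_one _).mpr IsSummand.refl.id_mem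
    rw [htop] at h
    refine h.hasHeredityChain (RingHom.id _) Function.surjective_id ?_
    ext γ
    rw [RingHom.mem_ker, RingHom.id_apply]
    refine ⟨fun h => h ▸ zero_mem _, fun h => ?_⟩
    rw [mem_facIdeal, facMaps] at h
    have hle : AddSubgroup.closure {h | ∃ (g : M × N →ₗ[Λ] B) (f : B →ₗ[Λ] M × N), f ∘ₗ g = h} ≤
        ⊥ := by
      rw [AddSubgroup.closure_le]
      rintro _ ⟨g, f, rfl⟩
      rw [Subsingleton.elim g 0, LinearMap.comp_zero]
      exact zero_mem _
    exact MulOpposite.unop_injective (AddSubgroup.mem_bot.mp (hle h))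

end Induction

/-! ### A criterion for the endomorphism ring of a lattice to be maximal -/

section MaximalOrder

variable {R : Type u} [CommRing R] [IsDomain R] [IsDiscreteValuationRing R]

theorem isArtinian_of_smul_eq_zero {N : Type*} [AddCommGroup N] [Module R N] [Module.Finite R N]
    {r : R} (hr : r ≠ 0) (h : ∀ x : N, r • x = 0) : IsArtinian R N := by
  have := (isFiniteLength_iff_isNoetherian_isArtinian.mp
    (isFiniteLength_quotient_span_singleton R (mem_nonZeroDivisors_of_ne_zero hr))).2
  obtain ⟨n, s, hs⟩ := Module.Finite.exists_fin (R := R) (M := N)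
  let q : N → (R ⧸ Ideal.span {r}) →ₗ[R] N := fun x =>
    Submodule.liftQ _ (LinearMap.toSpanSingleton R N x) <| by
      rw [Ideal.span, Submodule.span_le]
      rintro _ rfl
      simp [h]
  have hq : ∀ x, q x (Submodule.Quotient.mk 1) = x := fun x =>
    (Submodule.liftQ_apply _ _ _).trans (one_smul R x)
  let f : (Fin n → R ⧸ Ideal.span {r}) →ₗ[R] N := ∑ i, q (s i) ∘ₗ LinearMap.proj i
  refine isArtinian_of_surjective _ f ?_
  rw [← LinearMap.range_eq_top, eq_top_iff, ← hs, Submodule.span_le]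
  rintro _ ⟨i, rfl⟩
  refine ⟨Pi.single i (Submodule.Quotient.mk 1), ?_⟩
  simp only [f, LinearMap.sum_apply, LinearMap.comp_apply, LinearMap.proj_apply]
  rw [Finset.sum_eq_single i]
  · rw [Pi.single_eq_same, hq]
  · intro j _ hj
    rw [Pi.single_eq_of_ne hj, map_zero]
  · simp

theorem isArtinianRing_of_algebraMap_eq_zero {Γ : Type*} [Ring Γ] [Algebra R Γ] [Module.Finite R Γ]
    {r : R} (hr : r ≠ 0) (h : algebraMap R Γ r = 0) : IsArtinianRing Γ := by
  have : IsArtinian R Γ := isArtinian_of_smul_eq_zero hr fun x => by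
    rw [Algebra.smul_def, h, zero_mul]
  exact isArtinian_of_tower R this

theorem Ideal.isTwoSided_sup {Γ : Type*} [Ring Γ] (I J : Ideal Γ) [I.IsTwoSided] [J.IsTwoSided] :
    (I ⊔ J).IsTwoSided := by
  refine ⟨fun {a} b ha => ?_⟩
  obtain ⟨x, hx, y, hy, rfl⟩ := Submodule.mem_sup.mp ha
  rw [add_mul]
  exact Submodule.add_mem_sup (I.mul_mem_right _ hx) (J.mul_mem_right _ hy)

theorem exists_jacobson_pow_le {Γ : Type*} [Ring Γ] (I : Ideal Γ) [I.IsTwoSided]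
    [IsArtinianRing (Γ ⧸ I)] : ∃ n : ℕ, Ring.jacobson Γ ^ n ≤ I := by
  obtain ⟨n, hn⟩ : IsNilpotent (Ring.jacobson (Γ ⧸ I)) := IsSemiprimaryRing.isNilpotent
  refine ⟨n, fun x hx => ?_⟩
  have key : ∀ n : ℕ, Ring.jacobson Γ ^ n ≤
      (Ring.jacobson (Γ ⧸ I) ^ n).comap (Ideal.Quotient.mk I) := by
    intro n
    induction n with
    | zero => simp [Submodule.pow_zero, Ideal.one_eq_top]
    | succ n ih =>
      rw [Submodule.pow_succ, Submodule.pow_succ]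
      refine Ideal.mul_le.mpr fun a ha b hb => ?_
      rw [Ideal.mem_comap, map_mul]
      have : RingHomSurjective (Ideal.Quotient.mk I) := ⟨Ideal.Quotient.mk_surjective⟩
      exact Ideal.mul_mem_mul (ih ha) (Ring.le_comap_jacobson (Ideal.Quotient.mk I) hb)
  have := key n hx
  rw [hn] at this
  exact Ideal.Quotient.eq_zero_iff_mem.mp this

/-- A proper two-sided ideal with artinian quotient that contains no product of two strictly
larger two-sided ideals contains the radical. -/
theorem jacobson_le_of_mul_not_le {Γ : Type*} [Ring Γ] (I : Ideal Γ) [I.IsTwoSided] (hI : I ≠ ⊤)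
    [IsArtinianRing (Γ ⧸ I)]
    (h : ∀ D B : Ideal Γ, D.IsTwoSided → B.IsTwoSided → I < D → I < B → ¬ D * B ≤ I) :
    Ring.jacobson Γ ≤ I := by
  obtain ⟨n, hn⟩ := exists_jacobson_pow_le I
  induction n with
  | zero =>
    rw [Submodule.pow_zero, Ideal.one_eq_top, top_le_iff] at hn
    exact absurd hn hI
  | succ n ih =>
    by_cases hn' : Ring.jacobson Γ ^ n ≤ I
    · exact ih hn'
    by_contra hJ
    -- For Jⁿ⁺¹ ⊆ I with neither J nor Jⁿ inside I, the ideals I + J and I + Jⁿ are strictly larger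
    -- than I, but their product lies in I.
    refine h (I ⊔ Ring.jacobson Γ) (I ⊔ Ring.jacobson Γ ^ n) (Ideal.isTwoSided_sup _ _)
      (Ideal.isTwoSided_sup _ _) (left_lt_sup.mpr hJ) (left_lt_sup.mpr hn') ?_
    refine Ideal.mul_le.mpr fun a ha b hb => ?_
    obtain ⟨x, hx, y, hy, rfl⟩ := Submodule.mem_sup.mp ha
    obtain ⟨z, hz, t, ht, rfl⟩ := Submodule.mem_sup.mp hb
    rw [add_mul, mul_add y]
    refine add_mem (I.mul_mem_right _ hx) (add_mem (I.mul_mem_left _ hz) (hn ?_))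
    have hn0 : n ≠ 0 := by
      rintro rfl
      apply hJ
      rwa [Submodule.pow_succ, Submodule.pow_zero, Ideal.one_eq_top, Ideal.top_mul] at hn
    rw [Submodule.pow_succ' _ hn0]
    exact Ideal.mul_mem_mul hy ht

/-- Among the full two-sided ideals I with I b ⊆ I for some b ∈ B outside Γ, a maximal one is prime
in the sense of `jacobson_le_of_mul_not_le`, so it contains the radical. -/
theorem exists_ideal_stable_of_not_surjective {Γ B : Type*} [Ring Γ] [Algebra R Γ]
    [Module.Finite R Γ] [Ring B] [Algebra R B] [Module.Finite R B] (φ : Γ →ₐ[R] B)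
    (hφ : Function.Injective φ)
    (htors : Module.IsTorsion R (B ⧸ LinearMap.range φ.toLinearMap))
    (hsurj : ¬ Function.Surjective φ) :
    ∃ I : Ideal Γ, I.IsTwoSided ∧ Ring.jacobson Γ ≤ I ∧ (∃ r : R, r ≠ 0 ∧ algebraMap R Γ r ∈ I) ∧
      ∃ b, b ∉ Set.range φ ∧ ∀ c ∈ I, ∃ c' ∈ I, φ c' = φ c * b := by
  have : IsNoetherianRing Γ := isNoetherian_of_tower R inferInstance
  let F : Set (Ideal Γ) := {I | I.IsTwoSided ∧ (∃ r : R, r ≠ 0 ∧ algebraMap R Γ r ∈ I) ∧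
      ∃ b, b ∉ Set.range φ ∧ ∀ c ∈ I, ∃ c' ∈ I, φ c' = φ c * b}
  have hF : F.Nonempty := by
    -- The conductor {x | x B ⊆ Γ}: it is full because B/Γ is killed by a nonzero scalar, and every
    -- b ∈ B stabilizes it.
    let I : Ideal Γ :=
      { carrier := {x | ∀ b, φ x * b ∈ φ.range}
        add_mem' := fun hx hy b => by
          rw [map_add, add_mul]; exact add_mem (hx b) (hy b)
        zero_mem' := fun b => by rw [map_zero, zero_mul]; exact zero_mem _
        smul_mem' := fun y x hx b => by
          rw [smul_eq_mul, map_mul, mul_assoc]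
          exact mul_mem ⟨y, rfl⟩ (hx b) }
    refine ⟨I, ⟨fun {x} y hx b => ?_⟩, ?_, ?_⟩
    · rw [map_mul, mul_assoc]
      exact hx _
    · obtain ⟨r, hr, hr0⟩ := Submodule.annihilator_top_inter_nonZeroDivisors htors
      refine ⟨r, nonZeroDivisors.ne_zero hr0, fun b => ?_⟩
      rw [AlgHom.commutes, ← Algebra.smul_def]
      have h1 := Submodule.mem_annihilator.mp hr (Submodule.Quotient.mk b) Submodule.mem_top
      rw [← Submodule.Quotient.mk_smul, Submodule.Quotient.mk_eq_zero] at h1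
      exact h1
    · obtain ⟨b, hb⟩ := not_forall.mp hsurj
      refine ⟨b, hb, fun c hc => ?_⟩
      obtain ⟨x, hx⟩ := hc b
      refine ⟨x, fun b' => ?_, hx⟩
      have hx' : φ x = φ c * b := hx
      rw [hx', mul_assoc]
      exact hc _
  obtain ⟨I, ⟨hI, ⟨r, hr, hrI⟩, b, hb, hbI⟩, hmax⟩ :=
    (wellFounded_gt (α := Ideal Γ)).has_min F hF
  have hI1 : I ≠ ⊤ := by
    intro h
    obtain ⟨c', -, hc'⟩ := hbI 1 (h ▸ Submodule.mem_top)
    exact hb ⟨c', by simpa using hc'⟩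
  have : IsArtinianRing (Γ ⧸ I) := by
    have : Module.Finite R (Γ ⧸ I) :=
      Module.Finite.of_surjective (Ideal.Quotient.mkₐ R I).toLinearMap
        (Ideal.Quotient.mkₐ_surjective R I)
    refine isArtinianRing_of_algebraMap_eq_zero hr ?_
    rw [← Ideal.Quotient.mk_algebraMap]
    exact Ideal.Quotient.eq_zero_iff_mem.mpr hrI
  refine ⟨I, hI, jacobson_le_of_mul_not_le I hI1 ?_, ⟨r, hr, hrI⟩, b, hb, hbI⟩
  intro D B' hD hB' hID hIB hDB
  -- If D B' ⊆ I, then Q = {x | D x ⊆ I} contains B'. For x ∈ Q, D(xb) ⊆ I b ⊆ I ⊆ D, so maximality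
  -- of I applied to D gives xb ∈ Γ, hence xb ∈ Q. Then Q contradicts maximality.
  let Q : Ideal Γ :=
    { carrier := {x | ∀ d ∈ D, d * x ∈ I}
      add_mem' := fun hx hy d hd => by rw [mul_add]; exact add_mem (hx d hd) (hy d hd)
      zero_mem' := fun d _ => by rw [mul_zero]; exact zero_mem _
      smul_mem' := fun y x hx d hd => by
        rw [smul_eq_mul, ← mul_assoc]; exact hx _ (D.mul_mem_right _ hd) }
  have hBQ : B' ≤ Q := fun x hx d hd => hDB (Ideal.mul_mem_mul hd hx)
  refine hmax Q ⟨⟨fun {x} y hx d hd => ?_⟩, ⟨r, hr, hBQ (hIB.le hrI)⟩, b, hb, fun x hx => ?_⟩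
    (hIB.trans_le hBQ)
  · rw [← mul_assoc]
    exact I.mul_mem_right _ (hx d hd)
  · have hDF : ∀ b', (∀ c ∈ D, ∃ c' ∈ I, φ c' = φ c * b') → b' ∈ Set.range φ := by
      intro b' hb'
      by_contra hb0
      refine hmax D ⟨hD, ⟨r, hr, hID.le hrI⟩, b', hb0, fun c hc => ?_⟩ hID
      obtain ⟨c', hc', h⟩ := hb' c hc
      exact ⟨c', hID.le hc', h⟩
    have hx' : ∀ c ∈ D, ∃ c' ∈ I, φ c' = φ c * (φ x * b) := fun c hc => by
      obtain ⟨c', hc', h⟩ := hbI _ (hx c hc)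
      exact ⟨c', hc', by rw [h, map_mul, mul_assoc]⟩
    obtain ⟨x', hx'b⟩ := hDF _ hx'
    refine ⟨x', fun d hd => ?_, hx'b⟩
    obtain ⟨c', hc', h⟩ := hx' d hd
    rw [← hx'b, ← map_mul] at h
    exact hφ h ▸ hc'

/-- An element b of a proper overorder with I b ⊆ I acts on L·I as β / s, where s b = β ∈ End(L). An
extension h of this action to L satisfies s h = β because L·I is full in L, so b = h is already in
End(L). -/
theorem isMaximalOrder_rightEnd {Λ : Type v} [Ring Λ] [Algebra R Λ] (L : Type w)
    [AddCommGroup L] [Module R L] [Module Λ L] [IsScalarTower R Λ L] [Module.Finite R L]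
    [Module.IsTorsionFree R L]
    (hT : ∀ I : Ideal (RightEnd Λ L), I.IsTwoSided → Ring.jacobson (RightEnd Λ L) ≤ I →
      ∀ g : idealRange I →ₗ[Λ] idealRange I, ∃ h : L →ₗ[Λ] L, ∀ x : idealRange I, h x = g x) :
    IsMaximalOrder R (RightEnd Λ L) := by
  have hfin := finite_rightEnd (R := R) (Λ := Λ) L
  have htf : Module.IsTorsionFree R (RightEnd Λ L) :=
    Function.Injective.moduleIsTorsionFree (MulOpposite.opLinearEquiv R).symm
      (MulOpposite.opLinearEquiv R).symm.injective fun _ _ => rfl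
  refine ⟨⟨hfin, inferInstance⟩, fun B _ _ hB φ hφ htors => ?_⟩
  by_contra hsurj
  have := hB.finite
  have := hB.projective
  have hBtf : Module.IsTorsionFree R B := inferInstance
  obtain ⟨I, hI, hJ, ⟨r, hr, hrI⟩, b, hb, hbI⟩ :=
    exists_ideal_stable_of_not_surjective φ hφ htors hsurj
  obtain ⟨⟨s, hs0⟩, hs⟩ := htors (x := Submodule.Quotient.mk b)
  have hs0' : s ≠ 0 := nonZeroDivisors.ne_zero hs0
  change s • (Submodule.Quotient.mk b : B ⧸ LinearMap.range φ.toLinearMap) = 0 at hs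
  rw [← Submodule.Quotient.mk_smul, Submodule.Quotient.mk_eq_zero] at hs
  obtain ⟨β, hβ⟩ := hs
  change φ β = s • b at hβ
  have key : ∀ x ∈ idealRange I, ∃ y ∈ idealRange I, s • y = β.unop x := by
    intro x hx
    rw [idealRange] at hx
    refine Submodule.iSup_induction _ (motive := fun x => ∃ y ∈ idealRange I, s • y = β.unop x)
      hx ?_ ⟨0, zero_mem _, by simp⟩ ?_
    · rintro ⟨c, hc⟩ _ ⟨x, rfl⟩
      obtain ⟨c', hc', h⟩ := hbI c hc
      refine ⟨c'.unop x, range_le_idealRange hc' ⟨x, rfl⟩, ?_⟩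
      have : s • c' = c * β := hφ (by rw [map_smul, map_mul, h, hβ, mul_smul_comm])
      exact LinearMap.congr_fun (congrArg MulOpposite.unop this) x
    · rintro x x' ⟨y, hy, h⟩ ⟨y', hy', h'⟩
      exact ⟨y + y', add_mem hy hy', by rw [smul_add, h, h', map_add]⟩
  choose! g hg hsg using key
  have hinj : Function.Injective (fun x : L => s • x) := smul_right_injective L hs0'
  let g' : idealRange I →ₗ[Λ] idealRange I :=
    { toFun := fun x => ⟨g x, hg x x.2⟩
      map_add' := fun x y => Subtype.ext <| hinj <| by
        simp only [Submodule.coe_add, smul_add, hsg _ x.2, hsg _ y.2,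
          hsg _ (add_mem x.2 y.2), map_add]
      map_smul' := fun a x => Subtype.ext <| hinj <| by
        simp only [Submodule.coe_smul, RingHom.id_apply, hsg _ (Submodule.smul_mem _ a x.2),
          map_smul, smul_comm s a, hsg _ x.2] }
  obtain ⟨h, hh⟩ := hT I hI hJ g'
  have h1 : ∀ x : L, s • h x = β.unop x := by
    intro x
    have hx : r • x ∈ idealRange I := range_le_idealRange hrI ⟨x, by
      rw [Algebra.algebraMap_eq_smul_one]; rfl⟩
    refine smul_right_injective L hr ?_
    have h2 : h (r • x) = g (r • x) := hh ⟨_, hx⟩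
    have h3 := hsg _ hx
    rw [← h2, LinearMap.map_smul_of_tower, LinearMap.map_smul_of_tower] at h3
    change r • s • h x = r • β.unop x
    rw [← h3, smul_comm]
  have h2 : s • MulOpposite.op h = β := MulOpposite.unop_injective (LinearMap.ext h1)
  refine hb ⟨MulOpposite.op h, smul_right_injective B hs0' ?_⟩
  change s • φ (MulOpposite.op h) = s • b
  rw [← map_smul, h2, hβ]

end MaximalOrder

/-! ### Ascending chain condition for full orders in a semisimple algebra -/

section Bounded

open IsLocalRing

variable {R : Type u} [CommRing R]

theorem Submodule.mem_smul_top_pi {ι : Type*} [Finite ι] {I : Ideal R} {x : ι → R} :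
    x ∈ (I • ⊤ : Submodule R (ι → R)) ↔ ∀ i, x i ∈ I := by
  classical
  have := Fintype.ofFinite ι
  refine ⟨fun hx i => ?_, fun hx => ?_⟩
  · refine Submodule.smul_induction_on hx (fun r hr y _ => ?_) fun a b ha hb => add_mem ha hb
    exact I.mul_mem_right _ hr
  · rw [← Finset.univ_sum_single x]
    refine sum_mem fun i _ => ?_
    have : Pi.single i (x i) = x i • (Pi.single i 1 : ι → R) := by
      rw [← Pi.single_smul, smul_eq_mul, mul_one]
    rw [this]
    exact Submodule.smul_mem_smul (hx i) Submodule.mem_top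

theorem IsPrecomplete.pi_of_ring {ι : Type*} [Finite ι] (I : Ideal R) [IsPrecomplete I R] :
    IsPrecomplete I (ι → R) := by
  refine ⟨fun f hf => ?_⟩
  have h : ∀ i, ∃ L, ∀ n, f n i ≡ L [SMOD (I ^ n • ⊤ : Submodule R R)] := fun i =>
    IsPrecomplete.prec inferInstance fun {m n} hmn => by
      have := hf hmn
      rw [SModEq.sub_mem, Submodule.mem_smul_top_pi] at this
      rw [SModEq.sub_mem, smul_eq_mul, Ideal.mul_top]
      exact this i
  choose L hL using h
  refine ⟨L, fun n => ?_⟩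
  rw [SModEq.sub_mem, Submodule.mem_smul_top_pi]
  intro i
  have := hL i n
  rwa [SModEq.sub_mem, smul_eq_mul, Ideal.mul_top] at this

/-- Complete Nakayama: generators modulo the maximal ideal lift to generators, as Rⁿ is complete and
U is separated. -/
theorem finite_of_finite_residueField_tensor [IsLocalRing R] [IsAdicComplete (maximalIdeal R) R]
    (U : Type*) [AddCommGroup U] [Module R U] [IsHausdorff (maximalIdeal R) U]
    [Module.Finite (ResidueField R) (ResidueField R ⊗[R] U)] : Module.Finite R U := by
  have hfin : Module.Finite R (U ⧸ (maximalIdeal R • ⊤ : Submodule R U)) := by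
    have : Module.Finite R (ResidueField R ⊗[R] U) := Module.Finite.trans (ResidueField R) _
    have : Module.Finite R ((R ⧸ maximalIdeal R) ⊗[R] U) :=
      inferInstanceAs (Module.Finite R (ResidueField R ⊗[R] U))
    exact Module.Finite.equiv (TensorProduct.quotTensorEquivQuotSMul U (maximalIdeal R))
  obtain ⟨n, s, hs⟩ := Module.Finite.exists_fin (R := R)
    (M := U ⧸ (maximalIdeal R • ⊤ : Submodule R U))
  choose t ht using fun i => Submodule.mkQ_surjective _ (s i)
  have : IsPrecomplete (maximalIdeal R) (Fin n → R) := IsPrecomplete.pi_of_ring _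
  have hsurj := surjective_of_mkQ_comp_surjective (I := maximalIdeal R)
    (f := Fintype.linearCombination R t) (by
      rw [← LinearMap.range_eq_top, eq_top_iff, ← hs, Submodule.span_le]
      rintro _ ⟨i, rfl⟩
      classical
      refine ⟨Pi.single i 1, ?_⟩
      rw [LinearMap.comp_apply, Fintype.linearCombination_apply_single, one_smul, ht])
  exact Module.Finite.of_surjective _ hsurj

variable [IsDomain R]

theorem Submodule.FG.exists_smul_le {V : Type*} [AddCommGroup V] [Module R V] {N : Submodule R V}
    (hN : N.FG) (D : Submodule R V) (hD : ∀ v ∈ N, ∃ r : R, r ≠ 0 ∧ r • v ∈ D) :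
    ∃ r : R, r ≠ 0 ∧ ∀ v ∈ N, r • v ∈ D := by
  obtain ⟨s, rfl⟩ := hN
  have key : ∀ v : s, ∃ r : R, r ≠ 0 ∧ r • (v : V) ∈ D := fun v => hD v (subset_span v.2)
  choose r hr hrD using key
  refine ⟨∏ v, r v, Finset.prod_ne_zero_iff.mpr fun v _ => hr v, fun v hv => ?_⟩
  have : span R (s : Set V) ≤ D.comap (LinearMap.lsmul R V (∏ v, r v)) := by
    rw [span_le]
    intro v hv
    change (∏ v, r v) • v ∈ D
    classical
    rw [← Finset.prod_erase_mul _ _ (Finset.mem_univ (⟨v, hv⟩ : s)), mul_smul]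
    exact D.smul_mem _ (hrD ⟨v, hv⟩)
  exact this hv

variable [IsDiscreteValuationRing R]

/-- Independent families in U scale into D, so their size is at most the rank of D. By flatness,
families independent over the residue field lift to independent ones, which bounds the dimension of
U modulo the maximal ideal. -/
theorem finite_of_isHausdorff [IsAdicComplete (maximalIdeal R) R]
    {U : Type*} [AddCommGroup U] [Module R U] [Module.IsTorsionFree R U]
    [IsHausdorff (maximalIdeal R) U] (D : Submodule R U) [Module.Finite R D]
    (hD : ∀ u : U, ∃ r : R, r ≠ 0 ∧ r • u ∈ D) : Module.Finite R U := by
  have hcard : ∀ (n : ℕ) (b : Fin n → U), LinearIndependent R b → n ≤ Module.finrank R D := by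
    intro n b hb
    obtain ⟨r, hr, hrD⟩ := Submodule.FG.exists_smul_le
      (Submodule.fg_span (Set.finite_range b)) D fun v _ => hD v
    have hli : LinearIndependent R (fun i => (⟨r • b i, hrD _ (Submodule.subset_span ⟨i, rfl⟩)⟩ : D)) := by
      rw [← LinearMap.linearIndependent_iff D.subtype (Submodule.ker_subtype D)]
      have : D.subtype ∘ (fun i => (⟨r • b i, hrD _ (Submodule.subset_span ⟨i, rfl⟩)⟩ : D)) =
          LinearMap.lsmul R U r ∘ b := rfl
      rw [this]
      exact hb.map' _ (LinearMap.ker_eq_bot.mpr (smul_right_injective U hr))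
    simpa using hli.fintype_card_le_finrank
  have hrank : Module.rank (ResidueField R) (ResidueField R ⊗[R] U) ≤
      (Module.finrank R D : ℕ) := by
    refine _root_.rank_le fun s hs => ?_
    have hsurj : Function.Surjective (TensorProduct.mk R (ResidueField R) U 1) :=
      TensorProduct.mk_surjective R U (ResidueField R) Ideal.Quotient.mk_surjective
    choose t ht using hsurj
    let e := s.equivFin.symm
    have hli : LinearIndependent (ResidueField R)
        (TensorProduct.mk R (ResidueField R) U 1 ∘ fun i => t (e i)) := by
      have : (TensorProduct.mk R (ResidueField R) U 1 ∘ fun i => t (e i)) =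
          (fun i : s => (i : ResidueField R ⊗[R] U)) ∘ e := by
        funext i
        exact ht _
      rw [this]
      exact hs.comp _ e.injective
    exact hcard _ _ (Module.IsLocalRing.linearIndependent_of_flat _ hli)
  have : Module.Finite (ResidueField R) (ResidueField R ⊗[R] U) :=
    Module.rank_lt_aleph0_iff.mp (hrank.trans_lt (Cardinal.natCast_lt_aleph0))
  exact finite_of_finite_residueField_tensor U

variable {A : Type*} [Ring A] [Algebra R A]

/-- The infinitely divisible elements of U form a left ideal W of A, because U is full. By
semisimplicity an idempotent e generates W, and integrality of U forces e = 0. -/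
theorem isHausdorff_subalgebra [IsSemisimpleRing A] [Module.IsTorsionFree R A]
    (U : Subalgebra R A) (hU : ∀ u ∈ U, ∃ B : Subalgebra R A, Module.Finite R B ∧ u ∈ B)
    (hfull : ∀ a : A, ∃ r : R, r ≠ 0 ∧ r • a ∈ U) : IsHausdorff (maximalIdeal R) U := by
  let W : Ideal A :=
    { carrier := {a | ∀ r : R, r ≠ 0 → ∃ u ∈ U, r • u = a}
      add_mem' := fun ha hb r hr => by
        obtain ⟨u, hu, rfl⟩ := ha r hr
        obtain ⟨v, hv, rfl⟩ := hb r hr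
        exact ⟨u + v, add_mem hu hv, smul_add _ _ _⟩
      zero_mem' := fun r _ => ⟨0, zero_mem _, smul_zero _⟩
      smul_mem' := fun b a ha r hr => by
        obtain ⟨s, hs, hsb⟩ := hfull b
        obtain ⟨u, hu, rfl⟩ := ha (r * s) (mul_ne_zero hr hs)
        refine ⟨s • b * u, mul_mem hsb hu, ?_⟩
        rw [smul_eq_mul, mul_smul, mul_smul_comm, mul_smul_comm, smul_mul_assoc] }
  obtain ⟨ϖ, hϖ⟩ := IsDiscreteValuationRing.exists_irreducible R
  have hW : W = ⊥ := by
    obtain ⟨e, he, hWe⟩ := IsSemisimpleRing.ideal_eq_span_idempotent W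
    have heW : e ∈ W := hWe ▸ Ideal.mem_span_singleton_self e
    obtain ⟨u, hu, hue⟩ := heW ϖ hϖ.ne_zero
    obtain ⟨B, hB, huB⟩ := hU u hu
    -- From e = ϖu and e² = e. Hence Bu ⊆ ϖBu for a finite subalgebra B containing u, and Nakayama
    -- gives u = 0.
    have huu : ϖ • (u * u) = u := by
      refine smul_right_injective A hϖ.ne_zero ?_
      change ϖ • ϖ • (u * u) = ϖ • u
      rw [← smul_mul_assoc, ← mul_smul_comm, hue, he.eq]
    let N : Submodule R A := (Subalgebra.toSubmodule B).map (LinearMap.mulRight R u)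
    have hN : N = ⊥ := by
      refine Submodule.eq_bot_of_le_smul_of_le_jacobson_bot (maximalIdeal R) N
        (Submodule.FG.map _ (Module.Finite.iff_fg.mp hB)) ?_ (maximalIdeal_le_jacobson _)
      rintro _ ⟨a, ha, rfl⟩
      have : LinearMap.mulRight R u a = ϖ • LinearMap.mulRight R u (a * u) := by
        simp only [LinearMap.mulRight_apply]
        rw [mul_assoc, ← mul_smul_comm, huu]
      rw [this]
      exact Submodule.smul_mem_smul ((mem_maximalIdeal ϖ).mpr hϖ.not_isUnit)
        ⟨a * u, B.mul_mem ha huB, rfl⟩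
    have hu0 : u = 0 := by
      have : u ∈ N := ⟨1, one_mem B, by simp⟩
      rwa [hN] at this
    rw [hWe, ← hue, hu0, smul_zero, Ideal.span_singleton_eq_bot]
  refine ⟨fun x hx => Subtype.ext ?_⟩
  change (x : A) ∈ (⊥ : Ideal A)
  rw [← hW]
  intro r hr
  obtain ⟨n, c, hc⟩ := IsDiscreteValuationRing.associated_pow_irreducible hr hϖ
  have h1 := hx n
  rw [SModEq.zero, hϖ.maximalIdeal_eq, Ideal.span_singleton_pow,
    Submodule.ideal_span_singleton_smul, Submodule.mem_smul_pointwise_iff_exists] at h1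
  obtain ⟨y, -, hy⟩ := h1
  refine ⟨(c : R) • y, U.smul_mem y.2 _, ?_⟩
  rw [smul_smul, hc, ← hy]
  rfl

theorem finite_subalgebra [IsAdicComplete (maximalIdeal R) R] [IsSemisimpleRing A]
    [Module.IsTorsionFree R A] (U D : Subalgebra R A)
    (hU : ∀ u ∈ U, ∃ B : Subalgebra R A, Module.Finite R B ∧ u ∈ B) (hDU : D ≤ U)
    [Module.Finite R D] (hfull : ∀ a : A, ∃ r : R, r ≠ 0 ∧ r • a ∈ D) : Module.Finite R U := by
  have := isHausdorff_subalgebra U hU fun a => by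
    obtain ⟨r, hr, h⟩ := hfull a
    exact ⟨r, hr, hDU h⟩
  let D' : Submodule R U := (Subalgebra.toSubmodule D).comap U.val.toLinearMap
  have : Module.Finite R D' := Module.Finite.of_injective
    (LinearMap.codRestrict (Subalgebra.toSubmodule D) (U.val.toLinearMap ∘ₗ D'.subtype)
      fun x => x.2 : D' →ₗ[R] D) fun x y h => by
      have h1 := congrArg Subtype.val h
      exact Subtype.ext (Subtype.ext h1)
  exact finite_of_isHausdorff D' fun u => hfull u

/-- The union of an ascending chain is again a finite R-module, so one member of the chain contains
all its generators. -/
theorem wellFoundedGT_full_orders [IsAdicComplete (maximalIdeal R) R] [IsSemisimpleRing A]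
    [Module.IsTorsionFree R A] :
    WellFoundedGT {B : Subalgebra R A // Module.Finite R B ∧
      ∀ a : A, ∃ r : R, r ≠ 0 ∧ r • a ∈ B} := by
  rw [wellFoundedGT_iff_monotone_chain_condition]
  intro f
  have hdir : Directed (· ≤ ·) fun n => (f n).1 :=
    Monotone.directed_le fun m n h => f.monotone h
  have hmem : ∀ u, u ∈ ⨆ n, (f n).1 ↔ ∃ n, u ∈ (f n).1 := fun u => by
    rw [← SetLike.mem_coe, Subalgebra.coe_iSup_of_directed hdir, Set.mem_iUnion]
    rfl
  have := (f 0).2.1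
  have hfin := finite_subalgebra (⨆ n, (f n).1) (f 0).1
    (fun u hu => by
      obtain ⟨n, hn⟩ := (hmem u).mp hu
      exact ⟨_, (f n).2.1, hn⟩) (le_iSup (fun n => (f n).1) 0) (f 0).2.2
  obtain ⟨s, hs⟩ : (Subalgebra.toSubmodule (⨆ n, (f n).1)).FG := Module.Finite.iff_fg.mp hfin
  have hN : ∀ x : s, ∃ n, (x : A) ∈ (f n).1 := fun x => by
    rw [← hmem]
    have : (x : A) ∈ Submodule.span R (s : Set A) := Submodule.subset_span x.2
    rwa [hs] at this
  choose N hN using hN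
  refine ⟨Finset.univ.sup N, fun m hm => le_antisymm (f.monotone hm) ?_⟩
  have h1 : Submodule.span R (s : Set A) ≤ Subalgebra.toSubmodule (f (Finset.univ.sup N)).1 := by
    rw [Submodule.span_le]
    exact fun x hx => f.monotone (Finset.le_sup (Finset.mem_univ (⟨x, hx⟩ : s))) (hN ⟨x, hx⟩)
  rw [hs] at h1
  exact fun x hx => h1 ((hmem x).mpr ⟨m, hx⟩)

end Bounded

/-! ### The Jacobson radical of a finite algebra over a local ring -/

section Jacobson

open IsLocalRing

variable {R : Type u} [CommRing R] {Γ : Type*} [Ring Γ] [Algebra R Γ] [Module.Finite R Γ]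

theorem algebraMap_mem_jacobson [IsLocalRing R] {r : R} (hr : r ∈ maximalIdeal R) :
    algebraMap R Γ r ∈ Ring.jacobson Γ := by
  rw [← Ideal.jacobson_bot, Ideal.mem_jacobson_iff]
  intro y
  let P : Submodule R Γ := LinearMap.range (LinearMap.mulRight R (1 + r • y))
  have hP : (⊤ : Submodule R Γ) ≤ P := by
    refine Submodule.le_of_le_smul_of_le_jacobson_bot (I := maximalIdeal R)
      Module.Finite.fg_top (maximalIdeal_le_jacobson _) fun x _ => ?_
    have hx : x = x * (1 + r • y) + r • (-(x * y)) := by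
      rw [mul_add, mul_one, mul_smul_comm, smul_neg, add_neg_cancel_right]
    rw [hx]
    exact Submodule.add_mem_sup ⟨x, rfl⟩ (Submodule.smul_mem_smul hr Submodule.mem_top)
  obtain ⟨z, hz⟩ := hP (Submodule.mem_top (x := (1 : Γ)))
  refine ⟨z, ?_⟩
  rw [LinearMap.mulRight_apply] at hz
  rw [Ideal.mem_bot, mul_assoc, ← Algebra.commutes, ← Algebra.smul_def, sub_eq_zero, ← hz, mul_add,
    mul_one, add_comm]

theorem isSemisimpleRing_quotient_jacobson [IsDomain R] [IsDiscreteValuationRing R] :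
    IsSemisimpleRing (Γ ⧸ Ring.jacobson Γ) := by
  obtain ⟨ϖ, hϖ⟩ := IsDiscreteValuationRing.exists_irreducible R
  have : Module.Finite R (Γ ⧸ Ring.jacobson Γ) :=
    Module.Finite.of_surjective (Ideal.Quotient.mkₐ R (Ring.jacobson Γ)).toLinearMap
      (Ideal.Quotient.mkₐ_surjective R _)
  have : IsArtinianRing (Γ ⧸ Ring.jacobson Γ) := by
    refine isArtinianRing_of_algebraMap_eq_zero hϖ.ne_zero ?_
    rw [← Ideal.Quotient.mk_algebraMap]
    exact Ideal.Quotient.eq_zero_iff_mem.mpr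
      (algebraMap_mem_jacobson ((mem_maximalIdeal ϖ).mpr hϖ.not_isUnit))
  exact IsArtinianRing.isSemisimpleRing_iff_jacobson.mpr (Ring.jacobson_quotient_jacobson Γ)

end Jacobson

/-! ### Stabilizers of full lattices -/

section Stabilizer

variable {R : Type u} [CommRing R] {S : Type*} [Ring S] [Algebra R S]
variable {V : Type*} [AddCommGroup V] [Module R V] [Module S V] [IsScalarTower R S V]

/-- The `R`-algebra of endomorphisms of the `S`-module `V` that stabilize the lattice `D`. -/
def latticeStabilizer (S : Type*) [Ring S] [Algebra R S] [Module S V] [IsScalarTower R S V]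
    (D : Submodule R V) : Subalgebra R (Module.End S V) where
  carrier := {f | ∀ v ∈ D, f v ∈ D}
  mul_mem' hf hg v hv := hf _ (hg v hv)
  add_mem' hf hg v hv := add_mem (hf v hv) (hg v hv)
  algebraMap_mem' r _ hv := D.smul_mem r hv

theorem finite_latticeStabilizer [IsDomain R] [IsNoetherianRing R] [Module.IsTorsionFree R V]
    (D : Submodule R V) [Module.Finite R D]
    (hD : ∀ v : V, ∃ r : R, r ≠ 0 ∧ r • v ∈ D) :
    Module.Finite R (latticeStabilizer S D) := by
  let φ : latticeStabilizer S D →ₗ[R] (D →ₗ[R] D) :=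
    { toFun := fun f => (f.1.restrictScalars R).restrict f.2
      map_add' := fun _ _ => rfl
      map_smul' := fun _ _ => rfl }
  refine Module.Finite.of_injective φ fun f g hfg => Subtype.ext (LinearMap.ext fun v => ?_)
  obtain ⟨r, hr, hv⟩ := hD v
  refine smul_right_injective V hr ?_
  change r • f.1 v = r • g.1 v
  rw [← LinearMap.map_smul_of_tower, ← LinearMap.map_smul_of_tower]
  exact congrArg Subtype.val (LinearMap.congr_fun hfg ⟨_, hv⟩)

theorem full_latticeStabilizer [IsDomain R] (D : Submodule R V) [Module.Finite R D]
    (hD : ∀ v : V, ∃ r : R, r ≠ 0 ∧ r • v ∈ D) (a : Module.End S V) :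
    ∃ r : R, r ≠ 0 ∧ r • a ∈ latticeStabilizer S D := by
  obtain ⟨r, hr, h⟩ := Submodule.FG.exists_smul_le
    (Submodule.FG.map (a.restrictScalars R) (Module.Finite.iff_fg.mp ‹Module.Finite R D›)) D
    fun v _ => hD v
  exact ⟨r, hr, fun v hv => h _ ⟨v, hv, rfl⟩⟩

variable {Λ : Type v} [Ring Λ] {L : Type w} [AddCommGroup L] [Module R L] [Module Λ L]

theorem exists_restrict_of_mem_latticeStabilizer (σ : Λ →+* S) (ι : L →ₗ[R] V)
    (hι : Function.Injective ι) (hισ : ∀ (a : Λ) (x : L), ι (a • x) = σ a • ι x)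
    {f : Module.End S V} (hf : f ∈ latticeStabilizer S (LinearMap.range ι)) :
    ∃ h : L →ₗ[Λ] L, ∀ x, ι (h x) = f (ι x) := by
  have h1 : ∀ x, ∃ y, ι y = f (ι x) := fun x => hf _ ⟨x, rfl⟩
  choose h hh using h1
  refine ⟨{ toFun := h, map_add' := fun x y => hι ?_, map_smul' := fun a x => hι ?_ }, hh⟩
  · rw [map_add, hh, hh, hh, map_add, map_add]
  · rw [RingHom.id_apply, hισ, hh, hh, hισ, map_smul]

/-- Clear denominators: if r v = ι d, then f v is the unique w with r w = ι (g d). The relation `P`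
expresses this independently of the choice of r and d. -/
theorem exists_extend_endomorphism [IsDomain R] [Module.IsTorsionFree R V] [Algebra R Λ]
    [IsScalarTower R Λ L] (σ : Λ →+* S)
    (hS : ∀ s : S, ∃ r : R, r ≠ 0 ∧ ∃ a, r • s = σ a)
    (hV : ∀ (r : R) (v : V), r ≠ 0 → ∃ w, r • w = v) (ι : L →ₗ[R] V)
    (hι : Function.Injective ι) (hισ : ∀ (a : Λ) (x : L), ι (a • x) = σ a • ι x)
    (hfull : ∀ v : V, ∃ r : R, r ≠ 0 ∧ r • v ∈ LinearMap.range ι) (g : L →ₗ[Λ] L) :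
    ∃ f : Module.End S V, ∀ x, f (ι x) = ι (g x) := by
  have hg : ∀ (r : R) (x : L), g (r • x) = r • g x := fun r x => LinearMap.map_smul_of_tower g r x
  let P : V → V → Prop := fun v w => ∃ r : R, r ≠ 0 ∧ ∃ d : L, r • v = ι d ∧ r • w = ι (g d)
  have huniq : ∀ v w w', P v w → P v w' → w = w' := by
    rintro v w w' ⟨r, hr, d, h1, h2⟩ ⟨r', hr', d', h1', h2'⟩
    have hd : r' • d = r • d' := hι (by
      rw [map_smul, map_smul, ← h1, ← h1', smul_comm])
    refine smul_right_injective V (mul_ne_zero hr' hr) ?_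
    change (r' * r) • w = (r' * r) • w'
    rw [mul_smul, h2, mul_comm, mul_smul, h2', ← map_smul ι, ← map_smul ι, ← hg, ← hg, hd]
  have hex : ∀ v, ∃ w, P v w := fun v => by
    obtain ⟨r, hr, d, hd⟩ := hfull v
    obtain ⟨w, hw⟩ := hV r (ι (g d)) hr
    exact ⟨w, r, hr, d, hd.symm, hw⟩
  choose f hf using hex
  refine ⟨{ toFun := f, map_add' := fun v w => huniq (v + w) _ _ (hf _) ?_,
            map_smul' := fun s v => huniq (s • v) _ _ (hf _) ?_ }, fun x =>
    huniq (ι x) _ _ (hf _) ⟨1, one_ne_zero, x, one_smul _ _, one_smul _ _⟩⟩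
  · obtain ⟨r, hr, d, h1, h2⟩ := hf v
    obtain ⟨r', hr', d', h1', h2'⟩ := hf w
    refine ⟨r' * r, mul_ne_zero hr' hr, r' • d + r • d', ?_, ?_⟩
    · rw [smul_add, map_add, map_smul, map_smul, ← h1, ← h1', mul_smul, mul_comm, mul_smul]
    · rw [smul_add, map_add, map_add, hg, hg, map_smul, map_smul, ← h2, ← h2', mul_smul, mul_comm, mul_smul]
  · obtain ⟨r, hr, d, h1, h2⟩ := hf v
    obtain ⟨r', hr', a, ha⟩ := hS s
    have key : ∀ w : V, (r' * r) • s • w = σ a • r • w := fun w => by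
      rw [mul_smul, ← ha, smul_assoc, smul_comm r s w]
    refine ⟨r' * r, mul_ne_zero hr' hr, a • d, ?_, ?_⟩
    · rw [key, h1, hισ]
    · rw [RingHom.id_apply, key, h2, map_smul, hισ]

end Stabilizer

/-! ### Descent to a lattice with maximal endomorphism ring -/

section LatticeInduction

open IsLocalRing

variable {R : Type u} [CommRing R] [IsDomain R] [IsDiscreteValuationRing R]
  [IsAdicComplete (maximalIdeal R) R]
variable {S : Type*} [Ring S] [Algebra R S] [IsSemisimpleRing S]
variable {V : Type*} [AddCommGroup V] [Module R V] [Module S V] [IsScalarTower R S V]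
  [Module.IsTorsionFree R V] [Module.Finite S V]
variable {Λ : Type v} [Ring Λ] [Algebra R Λ]

theorem exists_hasHeredityCompletion_of_lattice (σ : Λ →+* S)
    (hS : ∀ s : S, ∃ r : R, r ≠ 0 ∧ ∃ a, r • s = σ a)
    (hV : ∀ (r : R) (v : V), r ≠ 0 → ∃ w, r • w = v) {ϖ : R} (hϖ : Irreducible ϖ)
    (L : Type w) [AddCommGroup L] [Module R L] [Module Λ L] [IsScalarTower R Λ L]
    [Module.Finite R L] (ι : L →ₗ[R] V) (hι : Function.Injective ι)
    (hισ : ∀ (a : Λ) (x : L), ι (a • x) = σ a • ι x)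
    (hfull : ∀ v : V, ∃ r : R, r ≠ 0 ∧ r • v ∈ LinearMap.range ι) :
    ∃ (B : Type w) (_ : AddCommGroup B) (_ : Module R B) (_ : Module Λ B)
      (_ : IsScalarTower R Λ B),
      IsMaximalOrder R (RightEnd Λ B) ∧ HasHeredityCompletion Λ ϖ B L := by
  have hA : IsSemisimpleRing (Module.End S V) := IsSemisimpleRing.moduleEnd S V
  have hwf := wellFoundedGT_full_orders (R := R) (A := Module.End S V)
  -- The induction is on the stabilizer: lattices can shrink forever, but their stabilizers cannot
  -- grow forever.
  suffices ∀ (t : {B : Subalgebra R (Module.End S V) // Module.Finite R B ∧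
      ∀ a : Module.End S V, ∃ r : R, r ≠ 0 ∧ r • a ∈ B})
      (L : Type w) [AddCommGroup L] [Module R L] [Module Λ L] [IsScalarTower R Λ L]
      [Module.Finite R L] (ι : L →ₗ[R] V), Function.Injective ι →
      (∀ (a : Λ) (x : L), ι (a • x) = σ a • ι x) →
      (∀ v : V, ∃ r : R, r ≠ 0 ∧ r • v ∈ LinearMap.range ι) →
      latticeStabilizer S (LinearMap.range ι) = t.1 →
      ∃ (B : Type w) (_ : AddCommGroup B) (_ : Module R B) (_ : Module Λ B)
        (_ : IsScalarTower R Λ B),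
        IsMaximalOrder R (RightEnd Λ B) ∧ HasHeredityCompletion Λ ϖ B L from
    this ⟨_, finite_latticeStabilizer _ hfull, full_latticeStabilizer _ hfull⟩ L ι hι hισ hfull rfl
  intro t
  induction t using WellFoundedGT.induction with
  | ind t ih =>
  intro L _ _ _ _ _ ι hι hισ hfull ht
  have hLtf : Module.IsTorsionFree R L :=
    Function.Injective.moduleIsTorsionFree ι hι fun r x => map_smul ι r x
  by_cases hT : ∀ I : Ideal (RightEnd Λ L), I.IsTwoSided → Ring.jacobson (RightEnd Λ L) ≤ I →
      ∀ g : idealRange I →ₗ[Λ] idealRange I, ∃ h : L →ₗ[Λ] L, ∀ x : idealRange I, h x = g x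
  · exact ⟨L, inferInstance, inferInstance, inferInstance, inferInstance,
      isMaximalOrder_rightEnd L hT, .refl ϖ L⟩
  push Not at hT
  obtain ⟨I, hI, hJ, g, hg⟩ := hT
  have := finite_rightEnd (R := R) (Λ := Λ) L
  have := isSemisimpleRing_quotient_jacobson (R := R) (Γ := RightEnd Λ L)
  have hfin : Module.Finite R (idealRange I) :=
    inferInstanceAs (Module.Finite R ((idealRange I).restrictScalars R))
  have hϖI : ∀ x : L, ϖ • x ∈ idealRange I := fun x =>
    range_le_idealRange (hJ (algebraMap_mem_jacobson (R := R)
      ((mem_maximalIdeal ϖ).mpr hϖ.not_isUnit))) ⟨x, by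
        rw [Algebra.algebraMap_eq_smul_one]; rfl⟩
  let ι' : idealRange I →ₗ[R] V := ι ∘ₗ (idealRange I).subtype.restrictScalars R
  have hι' : Function.Injective ι' := hι.comp (Submodule.subtype_injective _)
  have hισ' : ∀ (a : Λ) (x : idealRange I), ι' (a • x) = σ a • ι' x := fun a x => hισ a x
  have hfull' : ∀ v : V, ∃ r : R, r ≠ 0 ∧ r • v ∈ LinearMap.range ι' := by
    intro v
    obtain ⟨r, hr, x, hx⟩ := hfull v
    refine ⟨ϖ * r, mul_ne_zero hϖ.ne_zero hr, ⟨_, hϖI x⟩, ?_⟩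
    change ι (ϖ • x) = _
    rw [map_smul, hx, mul_smul]
  -- The inclusion holds because I is a right ideal as well. It is strict because g extends to V,
  -- and if that extension stabilized L it would extend g to L.
  have hlt : latticeStabilizer S (LinearMap.range ι) < latticeStabilizer S (LinearMap.range ι') := by
    refine lt_of_le_of_ne ?_ fun heq => ?_
    · rintro f hf _ ⟨x, rfl⟩
      obtain ⟨h, hh⟩ := exists_restrict_of_mem_latticeStabilizer σ ι hι hισ hf
      have hx : idealRange I ≤ (idealRange I).comap h := by
        refine idealRange_le.mpr ?_
        rintro b hb _ ⟨y, rfl⟩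
        exact range_le_idealRange (I.mul_mem_right (MulOpposite.op h) hb) ⟨y, rfl⟩
      exact ⟨⟨h x, hx x.2⟩, hh x⟩
    · obtain ⟨f, hf⟩ := exists_extend_endomorphism σ hS hV ι' hι' hισ' hfull' g
      have hmem : f ∈ latticeStabilizer S (LinearMap.range ι') := by
        rintro _ ⟨x, rfl⟩
        exact ⟨g x, (hf x).symm⟩
      rw [← heq] at hmem
      obtain ⟨h, hh⟩ := exists_restrict_of_mem_latticeStabilizer σ ι hι hισ hmem
      obtain ⟨x, hx⟩ := hg h
      exact hx (hι ((hh x).trans (hf x)))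
  obtain ⟨B, _, _, _, _, hB, hBL⟩ := ih
    ⟨_, finite_latticeStabilizer _ hfull', full_latticeStabilizer _ hfull'⟩
    (show t.1 < _ from ht ▸ hlt) (idealRange I) ι' hι' hισ' hfull' rfl
  exact ⟨B, inferInstance, inferInstance, inferInstance, inferInstance, hB,
    HasHeredityCompletion.step ϖ (idealRange I) (fun j hj => range_le_idealRange (hJ hj)) hϖI
      (traceSubmodule_idealRange I) hBL⟩

end LatticeInduction

/-! ### Direct summands, corners, and the ideal generated by the projection -/

section Corner

variable {R : Type u} [CommRing R]

theorem IsMaximalOrder.of_algEquiv {A A' : Type w} [Ring A] [Algebra R A] [Ring A'] [Algebra R A']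
    (h : IsMaximalOrder R A) (e : A ≃ₐ[R] A') : IsMaximalOrder R A' := by
  have := h.isOrder.finite
  have := h.isOrder.projective
  refine ⟨⟨Module.Finite.equiv e.toLinearEquiv, Module.Projective.of_equiv e.toLinearEquiv⟩,
    fun B _ _ hB φ hφ htors => ?_⟩
  have hr : LinearMap.range (φ.comp (e : A →ₐ[R] A')).toLinearMap =
      LinearMap.range φ.toLinearMap := by
    ext x
    constructor
    · rintro ⟨y, rfl⟩
      exact ⟨e y, rfl⟩
    · rintro ⟨y, rfl⟩
      exact ⟨e.symm y, congrArg φ (e.apply_symm_apply y)⟩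
  have hs := h.surjective B hB (φ.comp (e : A →ₐ[R] A')) (hφ.comp e.injective) (by rwa [hr])
  exact fun b => (hs b).imp' e fun _ h => h

variable {Λ : Type v} [Ring Λ] [Algebra R Λ]
variable {B : Type w} [AddCommGroup B] [Module R B] [Module Λ B] [IsScalarTower R Λ B]
variable {X : Type w} [AddCommGroup X] [Module R X] [Module Λ X] [IsScalarTower R Λ X]

/-- The endomorphism ring of a direct summand of `X` is a corner of the endomorphism ring
of `X`. -/
noncomputable def rightEndEquivCorner {i : B →ₗ[Λ] X} {p : X →ₗ[Λ] B}
    (hip : p ∘ₗ i = LinearMap.id)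
    (he : IsIdempotentElem (MulOpposite.op (i ∘ₗ p) : RightEnd Λ X)) :
    RightEnd Λ B ≃ₐ[R] he.Corner := by
  have hip' : ∀ x, p (i x) = x := LinearMap.congr_fun hip
  refine AlgEquiv.ofBijective
    { toFun := fun f => ⟨MulOpposite.op (i ∘ₗ f.unop ∘ₗ p),
        (Subsemigroup.mem_corner_iff he).mpr ⟨?_, ?_⟩⟩
      map_one' := rfl
      map_mul' := fun f g => Subtype.ext <| MulOpposite.unop_injective <| LinearMap.ext fun x => ?_
      map_zero' := Subtype.ext <| MulOpposite.unop_injective <| LinearMap.ext fun x => map_zero i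
      map_add' := fun f g => Subtype.ext <| MulOpposite.unop_injective <| LinearMap.ext fun x =>
        map_add i _ _
      commutes' := fun r => Subtype.ext <| MulOpposite.unop_injective <| LinearMap.ext fun x =>
        LinearMap.map_smul_of_tower i r (p x) } ⟨fun f g hfg => ?_, fun f => ?_⟩
  · exact MulOpposite.unop_injective (LinearMap.ext fun x => by simp [hip'])
  · exact MulOpposite.unop_injective (LinearMap.ext fun x => by simp [hip'])
  · change i (g.unop (f.unop (p x))) = i (g.unop (p (i (f.unop (p x)))))
    rw [hip']
  · refine MulOpposite.unop_injective (LinearMap.ext fun x => ?_)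
    have h1 := congrArg MulOpposite.unop (congrArg Subtype.val hfg)
    have h2 : i (f.unop (p (i x))) = i (g.unop (p (i x))) := LinearMap.congr_fun h1 (i x)
    rw [hip'] at h2
    rw [← hip' (f.unop x), h2, hip']
  · refine ⟨MulOpposite.op (p ∘ₗ f.1.unop ∘ₗ i), Subtype.ext ?_⟩
    obtain ⟨h1, h2⟩ := (Subsemigroup.mem_corner_iff he).mp f.2
    refine MulOpposite.unop_injective (LinearMap.ext fun x => ?_)
    have h3 := LinearMap.congr_fun (congrArg MulOpposite.unop h1) x
    have h4 := LinearMap.congr_fun (congrArg MulOpposite.unop h2) (i (p x))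
    have h5 : f.1.unop (i (p x)) = f.1.unop x := h3
    have h6 : i (p (f.1.unop (i (p x)))) = f.1.unop (i (p x)) := h4
    exact h6.trans h5

/-- Since p ∘ i = 1, a map f ∘ g through B equals (f ∘ p) ∘ (i ∘ p) ∘ (i ∘ g). -/
theorem span_mul_top_eq_facIdeal {i : B →ₗ[Λ] X} {p : X →ₗ[Λ] B}
    (hip : p ∘ₗ i = LinearMap.id) :
    Ideal.span {(MulOpposite.op (i ∘ₗ p) : RightEnd Λ X)} * (⊤ : Ideal (RightEnd Λ X)) =
      facIdeal Λ B X := by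
  refine le_antisymm (Ideal.mul_le.mpr fun a ha b _ => ?_) fun γ hγ => ?_
  · refine Ideal.mul_mem_right _ _ ?_
    refine (Ideal.span_singleton_le_iff_mem _).mpr ?_ ha
    exact comp_mem_facMaps i p
  · suffices ∀ f ∈ facMaps Λ B X X, MulOpposite.op f ∈
        Ideal.span {(MulOpposite.op (i ∘ₗ p) : RightEnd Λ X)} * (⊤ : Ideal (RightEnd Λ X)) from
      this _ hγ
    intro f hf
    induction hf using AddSubgroup.closure_induction with
    | mem x hx =>
      obtain ⟨g, f, rfl⟩ := hx
      have : (MulOpposite.op (f ∘ₗ g) : RightEnd Λ X) =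
          (MulOpposite.op (i ∘ₗ g) * MulOpposite.op (i ∘ₗ p)) * MulOpposite.op (f ∘ₗ p) := by
        have hip' : ∀ x, p (i x) = x := LinearMap.congr_fun hip
        exact MulOpposite.unop_injective (LinearMap.ext fun x => by simp [hip'])
      rw [this]
      exact Ideal.mul_mem_mul (Ideal.mul_mem_left _ _ (Ideal.mem_span_singleton_self _))
        Submodule.mem_top
    | zero => exact zero_mem _
    | add x y _ _ hx hy => exact add_mem hx hy
    | neg x _ hx => exact neg_mem hx

end Corner

/-! ### The theorem for orders -/

section Orders

theorem isLocalizedModule_fractionRing_tensor {R : Type u} [CommRing R] (N : Type*) [AddCommGroup N] [Module R N] :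
    IsLocalizedModule (nonZeroDivisors R) (TensorProduct.mk R (FractionRing R) N 1) :=
  (isLocalizedModule_iff_isBaseChange (nonZeroDivisors R) (FractionRing R) _).mpr
    (TensorProduct.isBaseChange R N (FractionRing R))

open IsLocalRing

variable {R : Type u} [CommRing R] [IsDomain R] [IsDiscreteValuationRing R]
variable {Λ : Type v} [Ring Λ] [Algebra R Λ]

theorem HasHeredityCompletion.exists_isQuasiHereditaryOrder {ϖ : R} (hϖ : ϖ ≠ 0)
    {B M : Type w} [AddCommGroup B] [Module R B] [Module Λ B] [IsScalarTower R Λ B]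
    [AddCommGroup M] [Module R M] [Module Λ M] [IsScalarTower R Λ M] [Module.Finite R M]
    [Module.IsTorsionFree R M] (hB : IsMaximalOrder R (RightEnd Λ B))
    (h : HasHeredityCompletion Λ ϖ B M) :
    ∃ (N : Type w) (_ : AddCommGroup N) (_ : Module R N) (_ : Module Λ N)
        (_ : IsScalarTower R Λ N),
        IsLattice R N ∧ IsQuasiHereditaryOrder R (RightEnd Λ (M × N)) := by
  obtain ⟨N, _, _, _, _, hN, htf, -, ⟨i, p, hip⟩, ⟨n, hn⟩, hX⟩ := h
  have := htf inferInstance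
  have hfin := finite_rightEnd (R := R) (Λ := Λ) (M × N)
  have htf' : Module.IsTorsionFree R (RightEnd Λ (M × N)) :=
    Function.Injective.moduleIsTorsionFree (MulOpposite.opLinearEquiv R).symm
      (MulOpposite.opLinearEquiv R).symm.injective fun _ _ => rfl
  have he : IsIdempotentElem (MulOpposite.op (i ∘ₗ p) : RightEnd Λ (M × N)) := by
    have hip' : ∀ x, p (i x) = x := LinearMap.congr_fun hip
    exact MulOpposite.unop_injective (LinearMap.ext fun x => by simp [hip'])
  refine ⟨N, inferInstance, inferInstance, inferInstance, inferInstance, ⟨hN, inferInstance⟩,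
    ⟨hfin, inferInstance⟩, MulOpposite.op (i ∘ₗ p), he,
    hB.of_algEquiv (rightEndEquivCorner hip he), ?_, ?_⟩
  · have hq : Module.Finite R (RightEnd Λ (M × N) ⧸
        (Ideal.span {(MulOpposite.op (i ∘ₗ p) : RightEnd Λ (M × N))} * ⊤)) :=
      Module.Finite.of_surjective (Ideal.Quotient.mkₐ R _).toLinearMap
        (Ideal.Quotient.mkₐ_surjective R _)
    refine isFiniteLength_iff_isNoetherian_isArtinian.mpr ⟨inferInstance, ?_⟩
    refine isArtinian_of_smul_eq_zero (pow_ne_zero n hϖ) fun x => ?_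
    obtain ⟨x, rfl⟩ := Ideal.Quotient.mk_surjective x
    -- Thus ϖⁿ kills the finitely generated quotient, which therefore has finite length.
    have h1 : ϖ ^ n • (1 : RightEnd Λ (M × N)) ∈ facIdeal Λ B (M × N) := hn
    have h2 : ϖ ^ n • x ∈ facIdeal Λ B (M × N) := by
      rw [← mul_one x, ← mul_smul_comm]
      exact Ideal.mul_mem_left _ _ h1
    rw [← span_mul_top_eq_facIdeal hip] at h2
    exact Ideal.Quotient.eq_zero_iff_mem.mpr h2
  · have h := hX (M × N) .refl .self
    have htop : facIdeal Λ (M × N) (M × N) = ⊤ :=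
      (Ideal.eq_top_iff_one _).mpr IsSummand.refl.id_mem
    rw [htop, ← span_mul_top_eq_facIdeal hip] at h
    exact h.hasHeredityChain (Ideal.Quotient.mk _) Ideal.Quotient.mk_surjective Ideal.mk_ker

theorem exists_smul_eq_one_tmul {N : Type*} [AddCommGroup N] [Module R N]
    (v : FractionRing R ⊗[R] N) : ∃ r : R, r ≠ 0 ∧ ∃ x : N, r • v = 1 ⊗ₜ x := by
  have := isLocalizedModule_fractionRing_tensor (R := R) N
  obtain ⟨⟨x, r⟩, h⟩ :=
    IsLocalizedModule.surj (nonZeroDivisors R) (TensorProduct.mk R (FractionRing R) N 1) v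
  exact ⟨r, nonZeroDivisors.ne_zero r.2, x, h⟩

theorem exists_isQuasiHereditaryOrder [IsAdicComplete (maximalIdeal R) R]
    (hΛ : IsSemisimpleRing (FractionRing R ⊗[R] Λ)) (M : Type w) [AddCommGroup M] [Module R M]
    [Module Λ M] [IsScalarTower R Λ M] [Module.Finite R M] [Module.IsTorsionFree R M] :
    ∃ (N : Type w) (_ : AddCommGroup N) (_ : Module R N) (_ : Module Λ N)
        (_ : IsScalarTower R Λ N),
        IsLattice R N ∧ IsQuasiHereditaryOrder R (RightEnd Λ (M × N)) := by
  obtain ⟨ϖ, hϖ⟩ := IsDiscreteValuationRing.exists_irreducible R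
  let K := FractionRing R
  let V := K ⊗[R] M
  let ρ : Λ →ₐ[R] Module.End K V :=
    (Module.End.baseChangeHom R K M).comp (Algebra.lsmul R R M)
  let τ : K ⊗[R] Λ →ₐ[K] Module.End K V := Algebra.TensorProduct.lift (Algebra.ofId K _) ρ
    fun x y => Algebra.commutes x (ρ y)
  -- The ambient space V = K ⊗ M needs its K ⊗ Λ-action: k ⊗ a acts by the scalar k times the base
  -- change of multiplication by a.
  let _ : Module (K ⊗[R] Λ) V := Module.compHom V τ.toRingHom
  have hτ : ∀ (k : K) (a : Λ) (v : V), (k ⊗ₜ[R] a : K ⊗[R] Λ) • v = k • ρ a v := by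
    intro k a v
    have h : τ (k ⊗ₜ a) = Algebra.ofId K _ k * ρ a := Algebra.TensorProduct.lift_tmul _ _ _ _ _
    change τ (k ⊗ₜ a) v = _
    rw [h]
    rfl
  have hKV : IsScalarTower K (K ⊗[R] Λ) V := ⟨fun k s v => by
    change τ (k • s) v = k • τ s v
    rw [map_smul]
    rfl⟩
  have hRV : IsScalarTower R (K ⊗[R] Λ) V := ⟨fun r s v => by
    change τ (r • s) v = r • τ s v
    rw [← algebraMap_smul K r s, map_smul, LinearMap.smul_apply, algebraMap_smul]⟩
  have hfinV : Module.Finite (K ⊗[R] Λ) V := Module.Finite.of_restrictScalars_finite K _ V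
  have hVtf : Module.IsTorsionFree R V := Module.IsTorsionFree.trans_faithfulSMul R K V
  let ι : M →ₗ[R] V := TensorProduct.mk R K M 1
  let σ : Λ →+* K ⊗[R] Λ := Algebra.TensorProduct.includeRight.toRingHom
  have hι : Function.Injective ι := fun x y hxy => by
    have := isLocalizedModule_fractionRing_tensor (R := R) M
    obtain ⟨c, hc⟩ := IsLocalizedModule.exists_of_eq (S := nonZeroDivisors R) (f := ι) hxy
    exact smul_right_injective M (nonZeroDivisors.ne_zero c.2) hc
  obtain ⟨B, _, _, _, _, hB, hBM⟩ := exists_hasHeredityCompletion_of_lattice (S := K ⊗[R] Λ)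
    (V := V) σ exists_smul_eq_one_tmul
    (fun r v hr => ⟨(algebraMap R K r)⁻¹ • v, by
      rw [← algebraMap_smul K r, smul_smul, mul_inv_cancel₀, one_smul]
      exact (map_ne_zero_iff _ (IsFractionRing.injective R K)).mpr hr⟩) hϖ M ι hι
    (fun a x => by
      change (1 : K) ⊗ₜ[R] (a • x) = (1 ⊗ₜ a : K ⊗[R] Λ) • ((1 : K) ⊗ₜ[R] x)
      rw [hτ, one_smul]
      rfl)
    (fun v => by
      obtain ⟨r, hr, x, hx⟩ := exists_smul_eq_one_tmul v
      exact ⟨r, hr, x, hx.symm⟩)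
  exact hBM.exists_isQuasiHereditaryOrder hϖ.ne_zero hB

end Orders

theorem mainTheorem6 (R : Type u) [CommRing R] (Λ : Type v) [Ring Λ] [Algebra R Λ]
    (M : Type w) [AddCommGroup M] [Module R M] [Module Λ M] [IsScalarTower R Λ M] :
    -- artin algebras
    (IsArtinAlgebra R Λ → Module.Finite Λ M →
      ∃ (N : Type w) (_ : AddCommGroup N) (_ : Module R N) (_ : Module Λ N)
        (_ : IsScalarTower R Λ N),
        Module.Finite Λ N ∧ IsQuasiHereditaryAlgebra R (RightEnd Λ (M × N))) ∧
    -- orders over complete discrete valuation rings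
    (∀ [IsDomain R] [IsDiscreteValuationRing R]
        [IsAdicComplete (IsLocalRing.maximalIdeal R) R],
      IsOrderInSemisimple R Λ → IsLattice R M →
      ∃ (N : Type w) (_ : AddCommGroup N) (_ : Module R N) (_ : Module Λ N)
        (_ : IsScalarTower R Λ N),
        IsLattice R N ∧ IsQuasiHereditaryOrder R (RightEnd Λ (M × N))) := by
  refine ⟨fun hΛ hM => ?_, fun hΛ hM => ?_⟩
  · have := hΛ.isArtinianRing
    have := hΛ.finite
    have : Module.Finite R M := Module.Finite.trans Λ M
    exact exists_isQuasiHereditaryAlgebra M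
  · have := hM.finite
    have := hM.projective
    exact exists_isQuasiHereditaryOrder hΛ.semisimple M
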